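/- Let $n\ge 2$ and $1<p<n$, and let $(M,g)$ be a (non-empty) smooth compact Riemannian manifold without boundary of dimension $n$. Let $\mathcal A_0(p)$ be the best constant in the Euclidean $L^p$-entropy inequality, i.e. the infimum of all $\mathcal A\in\mathbb R$ such that $$\int_{\mathbb R^n}|u|^p\log(|u|^p)\,dx\le\frac np\log\Big(\mathcal A\int_{\mathbb R^n}|\nabla u|^p\,dx\Big)$$ for all $u\in W^{1,p}(\mathbb R^n)$ with $\int_{\mathbb R^n}|u|^p\,dx=1$. Let $H^{1,p}(M)$ be the completion of $C^\infty(M)$ under the norm $\big(\int_M|\nabla_g u|^p\,dv_g+\int_M|u|^p\,dv_g\big)^{1/p}$, and let $\mathcal A_0(p,g)$ be the first Riemannian $L^p$-entropy best constant, i.e. the infimum of all $\mathcal A\in\mathbb R$ for which there exists $\mathcal B\in\mathbb R$ such that $$\int_M|u|^p\log(|u|^p)\,dv_g\le\frac np\log\Big(\mathcal A\int_M|\nabla_g u|^p\,dv_g+\mathcal B\Big)$$ for all $u\in H^{1,p}(M)$ with $\int_M|u|^p\,dv_g=1$. (Here $0\log 0=0$; the entropy integrals are taken in $[-\infty,+\infty]$,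 $\log t=-\infty$ for $t\le 0$, and the infima are taken in the extended reals.) Then $$\mathcal A_0(p,g)\ \ge\ \mathcal A_0(p).$$ -/

import Mathlib

open MeasureTheory Filter Topology Set
open scoped Manifold ContDiff ENNReal

noncomputable section

namespace EntropyConst

/-! ### The entropy functional -/

/-- The entropy `∫ |u|^p log (|u|^p) dμ`, as an extended real number: the integral of the positive
part minus the integral of the negative part. (On `ℝⁿ` the negative part of the integrand may have
infinite integral, in which case the entropy is `-∞`.) At zeros of `u` the integrand is `0`. -/
def entropy {X : Type*} [MeasurableSpace X] (μ : Measure X) (p : ℝ) (u : X → ℝ) : EReal :=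
  ((∫⁻ x, ENNReal.ofReal (|u x| ^ p * Real.log (|u x| ^ p)) ∂μ : ℝ≥0∞) : EReal) -
    ((∫⁻ x, ENNReal.ofReal (-(|u x| ^ p * Real.log (|u x| ^ p))) ∂μ : ℝ≥0∞) : EReal)

/-- The right-hand side `(n / p) log t` of the entropy inequalities, with `log t = -∞` for
`t ≤ 0`. -/
def logBound (n : ℕ) (p t : ℝ) : EReal :=
  ((n / p : ℝ) : EReal) * ENNReal.log (ENNReal.ofReal t)

/-! ### The Euclidean inequality -/

/-- `G` is the weak gradient of `u` on `ℝⁿ`: `∫ u ∂ᵢφ = - ∫ Gᵢ φ` for all test functions `φ`. -/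
def IsWeakGradient {n : ℕ} (u : EuclideanSpace ℝ (Fin n) → ℝ)
    (G : EuclideanSpace ℝ (Fin n) → EuclideanSpace ℝ (Fin n)) : Prop :=
  LocallyIntegrable u ∧ LocallyIntegrable G ∧
    ∀ φ : EuclideanSpace ℝ (Fin n) → ℝ, ContDiff ℝ ∞ φ → HasCompactSupport φ → ∀ i : Fin n,
      ∫ x, u x * fderiv ℝ φ x (EuclideanSpace.single i 1) = -∫ x, G x i * φ x

/-- `u ∈ W^{1,p}(ℝⁿ)`, with weak gradient `G`. -/
def MemSobolevEuclidean {n : ℕ} (p : ℝ) (u : EuclideanSpace ℝ (Fin n) → ℝ)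
    (G : EuclideanSpace ℝ (Fin n) → EuclideanSpace ℝ (Fin n)) : Prop :=
  MemLp u (ENNReal.ofReal p) ∧ MemLp G (ENNReal.ofReal p) ∧ IsWeakGradient u G

/-- The Euclidean `L^p`-entropy inequality on `ℝⁿ` with constant `A`. -/
def EuclideanEntropyInequality (n : ℕ) (p A : ℝ) : Prop :=
  ∀ (u : EuclideanSpace ℝ (Fin n) → ℝ) (G : EuclideanSpace ℝ (Fin n) → EuclideanSpace ℝ (Fin n)),
    MemSobolevEuclidean p u G → ∫ x, |u x| ^ p = 1 →
      entropy volume p u ≤ logBound n p (A * ∫ x, ‖G x‖ ^ p)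

/-- The best constant in the Euclidean `L^p`-entropy inequality: the infimum, in the extended
reals, of all admissible real constants. -/
def euclideanBestConst (n : ℕ) (p : ℝ) : EReal :=
  ⨅ (A : ℝ) (_ : EuclideanEntropyInequality n p A), (A : EReal)

/-! ### Riemannian metrics: volume, gradient, Sobolev functions -/

section Riemannian

variable {n : ℕ} {M : Type*} [TopologicalSpace M] [ChartedSpace (EuclideanSpace ℝ (Fin n)) M]
  [IsManifold (𝓡 n) ∞ M]

/-- A smooth Riemannian metric on an `n`-dimensional smooth manifold (without boundary). -/
abbrev Metric (n : ℕ) (M : Type*) [TopologicalSpace M]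
    [ChartedSpace (EuclideanSpace ℝ (Fin n)) M] [IsManifold (𝓡 n) ∞ M] : Type _ :=
  Bundle.ContMDiffRiemannianMetric (𝓡 n) ∞ (EuclideanSpace ℝ (Fin n))
    (fun q : M => TangentSpace (𝓡 n) q)

/-- The coordinate vector field `∂ᵢ` of the preferred chart at `x`, at the point with
coordinates `y`. -/
def coordVector (x : M) (y : EuclideanSpace ℝ (Fin n)) (i : Fin n) :
    TangentSpace (𝓡 n) ((chartAt (EuclideanSpace ℝ (Fin n)) x).symm y) :=
  mfderiv (𝓡 n) (𝓡 n) (chartAt (EuclideanSpace ℝ (Fin n)) x).symm y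
    (EuclideanSpace.single i (1 : ℝ) : EuclideanSpace ℝ (Fin n))

/-- The matrix `g_{ij} = g(∂ᵢ, ∂ⱼ)` in the preferred chart at `x`. -/
def gramMatrix (g : Metric n M) (x : M) (y : EuclideanSpace ℝ (Fin n)) :
    Matrix (Fin n) (Fin n) ℝ :=
  Matrix.of fun i j => g.inner ((chartAt (EuclideanSpace ℝ (Fin n)) x).symm y)
    (coordVector x y i) (coordVector x y j)

theorem exists_dual (g : Metric n M) (q : M) (ℓ : TangentSpace (𝓡 n) q →L[ℝ] ℝ) :
    ∃ w : TangentSpace (𝓡 n) q, ∀ v, g.inner q w v = ℓ v := by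
  let E := EuclideanSpace ℝ (Fin n)
  let T : E →ₗ[ℝ] (E →L[ℝ] ℝ) := (g.inner q).toLinearMap
  have hinj : Function.Injective T := by
    rw [← LinearMap.ker_eq_bot, LinearMap.ker_eq_bot']
    intro w hw
    by_contra h
    have h1 := g.pos q w h
    have h2 : g.inner q w w = 0 := congrArg (fun L : E →L[ℝ] ℝ => L w) hw
    exact h1.ne' h2
  have hdim : Module.finrank ℝ E = Module.finrank ℝ (E →L[ℝ] ℝ) :=
    ((InnerProductSpace.toDual ℝ E).toLinearEquiv.finrank_eq)
  obtain ⟨w, hw⟩ := (LinearMap.injective_iff_surjective_of_finrank_eq_finrank hdim).1 hinj ℓ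
  exact ⟨w, fun v => congrArg (fun L : E →L[ℝ] ℝ => L v) hw⟩

/-- The Riemannian gradient `∇_g u`: the tangent vector with `g(∇_g u, v) = du(v)` for all `v`. -/
def gradient (g : Metric n M) (u : M → ℝ) (q : M) : TangentSpace (𝓡 n) q :=
  Classical.choose (exists_dual g q (mfderiv (𝓡 n) 𝓘(ℝ, ℝ) u q))

theorem inner_gradient (g : Metric n M) (u : M → ℝ) (q : M) (v : TangentSpace (𝓡 n) q) :
    g.inner q (gradient g u q) v = mfderiv (𝓡 n) 𝓘(ℝ, ℝ) u q v :=
  Classical.choose_spec (exists_dual g q (mfderiv (𝓡 n) 𝓘(ℝ, ℝ) u q)) v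

/-- `|∇_g u|` at the point `q`. -/
def gradNorm (g : Metric n M) (u : M → ℝ) (q : M) : ℝ :=
  Real.sqrt (g.inner q (gradient g u q) (gradient g u q))

variable [MeasurableSpace M]

/-- The Riemannian volume on the domain of the preferred chart at `x` (zero outside of it): the
image under the inverse chart of `√(det g_{ij}) dy`. -/
def chartVolume (g : Metric n M) (x : M) : Measure M :=
  ((volume.restrict (chartAt (EuclideanSpace ℝ (Fin n)) x).target).withDensity
    (fun y => ENNReal.ofReal (Real.sqrt (gramMatrix g x y).det))).map
      (chartAt (EuclideanSpace ℝ (Fin n)) x).symm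

/-- The Riemannian volume measure `dv_g`. The local expressions `√(det g_{ij}) dy` agree on chart
overlaps, so the volume is the smallest measure dominating all of them. -/
def vol (g : Metric n M) : Measure M := ⨆ x : M, chartVolume g x

/-- `u ∈ H^{1,p}(M)` and `∫_M |∇_g u|^p dv_g = D`. Here `H^{1,p}(M)` is the completion of `C^∞(M)`
in the norm `(∫ |∇_g u|^p dv_g + ∫ |u|^p dv_g)^{1/p}`: its elements are the `L^p`-limits `u` of
sequences of smooth functions `v k` whose gradients form a Cauchy sequence in `L^p`, and `∇_g u` is
the limit of `∇_g (v k)` in `L^p`, so that `∫ |∇_g u|^p dv_g = lim ∫ |∇_g (v k)|^p dv_g`. -/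
def MemSobolev (g : Metric n M) (p : ℝ) (u : M → ℝ) (D : ℝ) : Prop :=
  MemLp u (ENNReal.ofReal p) (vol g) ∧
    ∃ v : ℕ → M → ℝ,
      (∀ k, ContMDiff (𝓡 n) 𝓘(ℝ, ℝ) ∞ (v k)) ∧
      Tendsto (fun k => eLpNorm (v k - u) (ENNReal.ofReal p) (vol g)) atTop (𝓝 0) ∧
      (∀ ε > 0, ∃ N, ∀ j ≥ N, ∀ k ≥ N, ∫ q, gradNorm g (v j - v k) q ^ p ∂vol g < ε) ∧
      Tendsto (fun k => ∫ q, gradNorm g (v k) q ^ p ∂vol g) atTop (𝓝 D)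

/-- The Riemannian `L^p`-entropy inequality `L(A, B)` on `(M, g)`. -/
def RiemannianEntropyInequality (g : Metric n M) (p A B : ℝ) : Prop :=
  ∀ (u : M → ℝ) (D : ℝ), MemSobolev g p u D → ∫ q, |u q| ^ p ∂vol g = 1 →
    entropy (vol g) p u ≤ logBound n p (A * D + B)

/-- The first Riemannian `L^p`-entropy best constant: the infimum, in the extended reals, of the
real `A` for which `L(A, B)` holds for some real `B`. -/
def riemannianBestConst (g : Metric n M) (p : ℝ) : EReal :=
  ⨅ (A : ℝ) (_ : ∃ B : ℝ, RiemannianEntropyInequality g p A B), (A : EReal)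

end Riemannian

end EntropyConst

end

/-! Every constant `A` admissible on `M`, with any `B` whatsoever, is admissible on `ℝⁿ`; the
inequality of infima is then inclusion of the admissible sets. The mechanism is concentration at a
point. Take a test function `φ` on `ℝⁿ`, a chart around a point of `M`, and linear coordinates `L`
in which the metric at that point is Euclidean. Transplant `z ↦ φ(z)`, shrunk by a factor `ε`, to
`M` and normalise its mass. Up to errors vanishing with `ε`, the entropy changes by `-n log ε` and
the Dirichlet integral by the factor `ε^(-p)`. With the factor `n/p` in front of the logarithm these
two effects cancel, while `B` acquires the factor `ε^p` and disappears in the limit. The metric is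
compared with the Euclidean one up to a factor `l > 1`, and `l` tends to `1` after `ε` tends to `0`.
This is `RiemannianEntropyInequality.transplant` followed by
`RiemannianEntropyInequality.entropyBound`.

What remains is to pass from test functions to all of `W^{1,p}(ℝⁿ)`, by mollification for compact
support (`EntropyBound.of_hasCompactSupport`) and by cutoffs in general
(`EntropyBound.of_memSobolev`). The entropy is not continuous under these limits:
`EntropyBound.of_tendsto` uses Fatou for its positive part and needs convergence only of the
negative part. If the negative part has infinite integral, the entropy is `-∞` and nothing is to be
proved.

Since the volume is a supremum of chart measures, the computation on `M` also rests on
`vol_restrict_source`: inside one chart domain the supremum is the measure of that chart. -/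

noncomputable section

namespace EntropyConst

/-! ### The entropy integrand -/

section Integrand

variable {X : Type*}

/-- The entropy integrand `|u|^p log (|u|^p)`. -/
def entDensity (p : ℝ) (u : X → ℝ) (x : X) : ℝ := |u x| ^ p * Real.log (|u x| ^ p)

theorem continuous_entDensity_real {p : ℝ} (hp : 0 < p) :
    Continuous fun t : ℝ => |t| ^ p * Real.log (|t| ^ p) :=
  Real.continuous_mul_log.comp (continuous_abs.rpow_const fun _ => Or.inr hp.le)

theorem neg_mul_log_le_one {s : ℝ} (hs : 0 ≤ s) : -(s * Real.log s) ≤ 1 := by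
  rcases hs.eq_or_lt with rfl | h
  · simp
  · have h1 := mul_le_mul_of_nonneg_left (Real.one_sub_inv_le_log_of_pos h) hs
    rw [mul_sub, mul_inv_cancel₀ h.ne'] at h1
    linarith

/-- Damping `s` by a factor `c ∈ [0, 1]` increases the negative part of `s log s` by at most `s`. -/
theorem negPart_mul_log_damp {c s : ℝ} (hc : 0 ≤ c) (hc1 : c ≤ 1) (hs : 0 ≤ s) :
    max (-(c * s * Real.log (c * s))) 0 ≤ max (-(s * Real.log s)) 0 + s := by
  refine max_le ?_ (add_nonneg (le_max_right _ _) hs)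
  rcases hs.eq_or_lt with rfl | hs'
  · simp
  rcases hc.eq_or_lt with rfl | hc'
  · simp only [zero_mul, Real.log_zero, neg_zero]
    exact add_nonneg (le_max_right _ _) hs
  rw [Real.log_mul hc'.ne' hs'.ne']
  -- Since `log (c s) = log c + log s`, the negative part splits into a multiple of `s`, at most
  -- `s`, and `c` times the original one.
  have h1 : -(c * Real.log c) * s ≤ 1 * s :=
    mul_le_mul_of_nonneg_right (neg_mul_log_le_one hc) hs
  have h2 : c * (-(s * Real.log s)) ≤ max (-(s * Real.log s)) 0 := by
    calc c * (-(s * Real.log s)) ≤ c * max (-(s * Real.log s)) 0 :=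
          mul_le_mul_of_nonneg_left (le_max_left _ _) hc
      _ ≤ 1 * max (-(s * Real.log s)) 0 :=
          mul_le_mul_of_nonneg_right hc1 (le_max_right _ _)
      _ = _ := one_mul _
  linarith

variable [MeasurableSpace X] {μ : Measure X}

theorem entropy_eq_of_integrable {p : ℝ} {u : X → ℝ} (h : Integrable (entDensity p u) μ) :
    entropy μ p u = ((∫ x, entDensity p u x ∂μ : ℝ) : EReal) := by
  have h1 := h.lintegral_lt_top
  have h2 : ∫⁻ x, ENNReal.ofReal (-(entDensity p u x)) ∂μ < ⊤ := h.neg.lintegral_lt_top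
  rw [integral_eq_lintegral_pos_part_sub_lintegral_neg_part h, EReal.coe_sub,
    EReal.coe_ennreal_toReal h1.ne, EReal.coe_ennreal_toReal h2.ne]
  rfl

/-- Subtracting `⊤` in `EReal` gives `⊥` even from `⊤`, so no control of the positive part is
needed. -/
theorem entropy_eq_bot {p : ℝ} {u : X → ℝ}
    (h : ∫⁻ x, ENNReal.ofReal (-(entDensity p u x)) ∂μ = ⊤) : entropy μ p u = ⊥ := by
  unfold entropy
  simp only [entDensity] at h
  rw [h, EReal.coe_ennreal_top, EReal.sub_top]

/-- The entropy inequality with constant `A` for the not necessarily normalised function `u`, where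
`Γ` stands for the Dirichlet integral, in exponential form. -/
structure EntropyBound (n : ℕ) (p A : ℝ) (μ : Measure X) (u : X → ℝ) (Γ : ℝ) : Prop where
  integrable : Integrable (entDensity p u) μ
  bound : Real.exp (p / n * ((∫ x, entDensity p u x ∂μ) / (∫ x, |u x| ^ p ∂μ) -
    Real.log (∫ x, |u x| ^ p ∂μ))) ≤ A * Γ / ∫ x, |u x| ^ p ∂μ

theorem EntropyBound.mono {n : ℕ} {p A : ℝ} {u : X → ℝ} {Γ Γ' : ℝ} (hA : 0 ≤ A)
    (h : EntropyBound n p A μ u Γ) (hΓ : Γ ≤ Γ') (hu : 0 < ∫ x, |u x| ^ p ∂μ) :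
    EntropyBound n p A μ u Γ' :=
  ⟨h.integrable, h.bound.trans (div_le_div_of_nonneg_right (mul_le_mul_of_nonneg_left hΓ hA) hu.le)⟩

theorem integral_entDensity_eq {p : ℝ} {u : X → ℝ} (h : Integrable (entDensity p u) μ) :
    ∫ x, entDensity p u x ∂μ =
      (∫ x, max (entDensity p u x) 0 ∂μ) - ∫ x, max (-(entDensity p u x)) 0 ∂μ := by
  rw [← integral_sub h.pos_part h.neg_part]
  refine integral_congr_ae (Eventually.of_forall fun x => ?_)
  simp only
  rcases le_total (entDensity p u x) 0 with h | h
  · rw [max_eq_right h, max_eq_left (by linarith)]; ring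
  · rw [max_eq_left h, max_eq_right (by linarith)]; ring

/-- The exponential inequality, solved for the positive part of the entropy. -/
theorem exp_bound_iff {n : ℕ} {p P N m R : ℝ} (hn : 0 < (n : ℝ)) (hp : 0 < p) (hm : 0 < m)
    (hR : 0 < R) :
    Real.exp (p / n * ((P - N) / m - Real.log m)) ≤ R ↔
      P ≤ N + m * (Real.log m + n / p * Real.log R) := by
  rw [← Real.le_log_iff_exp_le hR]
  have e : m * (p / n)⁻¹ * (p / n * ((P - N) / m - Real.log m)) = P - N - m * Real.log m := by
    field_simp
  have hpos : 0 < m * (p / n)⁻¹ := by positivity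
  rw [← mul_le_mul_iff_right₀ hpos, e, inv_div]
  constructor <;> intro h <;> nlinarith

/-- The bound solved for the positive part `P` reads `P ≤ N + m (log m + (n/p) log R)`, whose right
side converges. Fatou then bounds `P` in the limit, which yields the integrability of the limiting
density as well as the inequality; neither is presupposed. -/
theorem EntropyBound.of_tendsto {n : ℕ} {p A : ℝ} (hn : 0 < (n : ℝ)) (hp : 0 < p)
    {u : X → ℝ} {v : ℕ → X → ℝ} {Γ : ℝ} {γ : ℕ → ℝ}
    (hv : ∀ k, EntropyBound n p A μ (v k) (γ k))
    (hvm : ∀ k, AEMeasurable (v k) μ) (hum : AEMeasurable u μ)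
    (hlim : ∀ᵐ x ∂μ, Tendsto (fun k => v k x) atTop (𝓝 (u x)))
    (hv0 : ∀ k, 0 < ∫ x, |v k x| ^ p ∂μ) (hu0 : 0 < ∫ x, |u x| ^ p ∂μ)
    (hm : Tendsto (fun k => ∫ x, |v k x| ^ p ∂μ) atTop (𝓝 (∫ x, |u x| ^ p ∂μ)))
    (hneg : Integrable (fun x => max (-(entDensity p u x)) 0) μ)
    (hN : Tendsto (fun k => ∫ x, max (-(entDensity p (v k) x)) 0 ∂μ) atTop
      (𝓝 (∫ x, max (-(entDensity p u x)) 0 ∂μ)))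
    (hΓ : Tendsto γ atTop (𝓝 Γ)) : EntropyBound n p A μ u Γ := by
  set m := ∫ x, |u x| ^ p ∂μ
  set N := ∫ x, max (-(entDensity p u x)) 0 ∂μ
  set mk := fun k => ∫ x, |v k x| ^ p ∂μ
  set Nk := fun k => ∫ x, max (-(entDensity p (v k) x)) 0 ∂μ
  set Pk := fun k => ∫ x, max (entDensity p (v k) x) 0 ∂μ
  have hPk0 : ∀ k, 0 ≤ Pk k := fun k => integral_nonneg fun x => le_max_right _ _
  have hbd : ∀ k, Real.exp (p / n * ((Pk k - Nk k) / mk k - Real.log (mk k))) ≤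
      A * γ k / mk k := by
    intro k
    have := (hv k).bound
    rwa [integral_entDensity_eq (hv k).integrable] at this
  have hR : Tendsto (fun k => A * γ k / mk k) atTop (𝓝 (A * Γ / m)) :=
    (hΓ.const_mul A).div hm hu0.ne'
  have hlogm : Tendsto (fun k => Real.log (mk k)) atTop (𝓝 (Real.log m)) := hm.log hu0.ne'
  -- Dropping the nonnegative `Pk` from the exponent leaves a lower bound with a positive limit, so
  -- the right-hand sides stay away from `0` and their logarithms converge.
  have hRpos : 0 < A * Γ / m := by
    refine lt_of_lt_of_le (Real.exp_pos (p / n * ((0 - N) / m - Real.log m))) ?_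
    refine le_of_tendsto_of_tendsto' (((((tendsto_const_nhds.sub hN).div hm hu0.ne').sub
      hlogm).const_mul (p / n)).rexp) hR fun k => le_trans ?_ (hbd k)
    have := hPk0 k
    exact Real.exp_le_exp.2 (mul_le_mul_of_nonneg_left (sub_le_sub_right
      (div_le_div_of_nonneg_right (sub_le_sub_right this _) (hv0 k).le) _) (by positivity))
  have hRk : ∀ k, 0 < A * γ k / mk k := fun k => (Real.exp_pos _).trans_le (hbd k)
  have hbk : ∀ k, Pk k ≤ Nk k + mk k * (Real.log (mk k) + n / p * Real.log (A * γ k / mk k)) :=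
    fun k => (exp_bound_iff hn hp (hv0 k) (hRk k)).1 (hbd k)
  set b := N + m * (Real.log m + n / p * Real.log (A * Γ / m))
  have hb : Tendsto (fun k => Nk k + mk k * (Real.log (mk k) +
      n / p * Real.log (A * γ k / mk k))) atTop (𝓝 b) :=
    hN.add (hm.mul (hlogm.add ((hR.log hRpos.ne').const_mul _)))
  have hb0 : 0 ≤ b := ge_of_tendsto' hb fun k => (hPk0 k).trans (hbk k)
  have hcont := continuous_entDensity_real hp
  have hmeas : ∀ {w : X → ℝ}, AEMeasurable w μ → AEMeasurable (entDensity p w) μ := fun hw =>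
    hcont.measurable.comp_aemeasurable hw
  have hfatou : ∫⁻ x, ENNReal.ofReal (max (entDensity p u x) 0) ∂μ ≤ ENNReal.ofReal b := by
    calc ∫⁻ x, ENNReal.ofReal (max (entDensity p u x) 0) ∂μ
        ≤ ∫⁻ x, liminf (fun k => ENNReal.ofReal (max (entDensity p (v k) x) 0)) atTop ∂μ := by
          refine lintegral_mono_ae (hlim.mono fun x hx => ?_)
          have h1 := (hcont.tendsto (u x)).comp hx
          exact ((ENNReal.continuous_ofReal.tendsto _).comp
            (h1.max tendsto_const_nhds)).liminf_eq.ge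
      _ ≤ liminf (fun k => ∫⁻ x, ENNReal.ofReal (max (entDensity p (v k) x) 0) ∂μ) atTop :=
          lintegral_liminf_le' fun k => ((hmeas (hvm k)).max aemeasurable_const).ennreal_ofReal
      _ = liminf (fun k => ENNReal.ofReal (Pk k)) atTop := by
          congr 1
          ext k
          rw [ofReal_integral_eq_lintegral_ofReal (hv k).integrable.pos_part
            (Eventually.of_forall fun x => le_max_right _ _)]
      _ ≤ liminf (fun k => ENNReal.ofReal (Nk k + mk k * (Real.log (mk k) +
            n / p * Real.log (A * γ k / mk k)))) atTop :=
          liminf_le_liminf (Eventually.of_forall fun k => ENNReal.ofReal_le_ofReal (hbk k))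
      _ = ENNReal.ofReal b := ((ENNReal.continuous_ofReal.tendsto _).comp hb).liminf_eq
  have hpos : Integrable (fun x => max (entDensity p u x) 0) μ := by
    refine ⟨((hmeas hum).max aemeasurable_const).aestronglyMeasurable, ?_⟩
    rw [hasFiniteIntegral_iff_ofReal (Eventually.of_forall fun x => by exact le_max_right _ _)]
    exact hfatou.trans_lt ENNReal.ofReal_lt_top
  have hint : Integrable (entDensity p u) μ := by
    refine (hpos.sub hneg).congr (Eventually.of_forall fun x => ?_)
    simp only [Pi.sub_apply]
    rcases le_total (entDensity p u x) 0 with h | h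
    · rw [max_eq_right h, max_eq_left (by linarith)]; ring
    · rw [max_eq_left h, max_eq_right (by linarith)]; ring
  refine ⟨hint, ?_⟩
  rw [integral_entDensity_eq hint, exp_bound_iff hn hp hu0 hRpos]
  rw [← ofReal_integral_eq_lintegral_ofReal hpos
    (Eventually.of_forall fun x => le_max_right _ _)] at hfatou
  exact (ENNReal.ofReal_le_ofReal_iff hb0).1 hfatou

end Integrand

/-! ### Mollification -/

section Mollify

open scoped Convolution
open ContinuousLinearMap

variable {E F : Type*} [NormedAddCommGroup E] [InnerProductSpace ℝ E] [FiniteDimensional ℝ E]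
  [MeasurableSpace E] [BorelSpace E] [NormedAddCommGroup F] [NormedSpace ℝ F]

/-- Jensen's inequality for `t ↦ t^p` and the probability measure `ρ(t) dt`. -/
theorem norm_mollify_rpow_le {p : ℝ} (hp : 1 ≤ p) {ρ : E → ℝ} (hρc : Continuous ρ)
    (hρs : HasCompactSupport ρ) (hρ0 : ∀ x, 0 ≤ ρ x) (hρ1 : ∫ x, ρ x = 1) {G : E → F}
    (hG : LocallyIntegrable G) (hGp : Integrable fun x => ‖G x‖ ^ p) (x : E) :
    ‖(ρ ⋆[lsmul ℝ ℝ, volume] G) x‖ ^ p ≤ (ρ ⋆[lsmul ℝ ℝ, volume] fun y => ‖G y‖ ^ p) x := by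
  set ν : Measure E := volume.withDensity fun t => ENNReal.ofReal (ρ t) with hν
  have hρm : Measurable fun t => (ρ t).toNNReal := hρc.measurable.real_toNNReal
  have hint : Integrable ρ := hρc.integrable_of_hasCompactSupport hρs
  have : IsProbabilityMeasure ν := by
    constructor
    rw [hν, withDensity_apply _ MeasurableSet.univ, Measure.restrict_univ,
      ← ofReal_integral_eq_lintegral_ofReal hint (Eventually.of_forall hρ0), hρ1,
      ENNReal.ofReal_one]
  have hsm : ∀ (f : E → ℝ), ∫ t, f t ∂ν = ∫ t, ρ t * f t := by
    intro f
    rw [hν]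
    have := integral_withDensity_eq_integral_smul (μ := volume) hρm f
    simp only [NNReal.smul_def, Real.coe_toNNReal _ (hρ0 _), smul_eq_mul] at this
    exact this
  have hin : ∀ (f : E → ℝ), Integrable (fun t => ρ t * f t) → Integrable f ν := by
    intro f hf
    have := (integrable_withDensity_iff_integrable_smul (μ := volume) hρm (g := f)).2
    simp only [NNReal.smul_def, Real.coe_toNNReal _ (hρ0 _), smul_eq_mul] at this
    exact this hf
  have h1 : Integrable (fun t => ρ t * ‖G (x - t)‖) := by
    have := (hρs.convolutionExists_left (lsmul ℝ ℝ) hρc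
      (show LocallyIntegrable fun y => ‖G y‖ from fun y => (hG y).norm) x).integrable
    exact this
  have h2 : Integrable (fun t => ρ t * ‖G (x - t)‖ ^ p) := by
    have := (hρs.convolutionExists_left (lsmul ℝ ℝ) hρc hGp.locallyIntegrable x).integrable
    exact this
  have hJ := (convexOn_rpow hp).map_integral_le (μ := ν) (f := fun t => ‖G (x - t)‖)
    ((Real.continuous_rpow_const (by linarith)).continuousOn) isClosed_Ici
    (Eventually.of_forall fun t => norm_nonneg _) (hin _ h1) (hin _ h2)
  rw [hsm, hsm] at hJ
  refine le_trans (Real.rpow_le_rpow (norm_nonneg _) ?_ (by linarith)) hJ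
  refine (norm_integral_le_integral_norm _).trans (le_of_eq ?_)
  refine integral_congr_ae (Eventually.of_forall fun t => ?_)
  simp [norm_smul, abs_of_nonneg (hρ0 t)]

/-- Integrates the pointwise Jensen bound, the integral of a convolution being the product of the
integrals. -/
theorem integral_norm_mollify_rpow_le {p : ℝ} (hp : 1 ≤ p) {ρ : E → ℝ} (hρc : Continuous ρ)
    (hρs : HasCompactSupport ρ) (hρ0 : ∀ x, 0 ≤ ρ x) (hρ1 : ∫ x, ρ x = 1) {G : E → F}
    (hG : LocallyIntegrable G) (hGp : Integrable fun x => ‖G x‖ ^ p) :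
    ∫ x, ‖(ρ ⋆[lsmul ℝ ℝ, volume] G) x‖ ^ p ≤ ∫ x, ‖G x‖ ^ p := by
  have hint : Integrable ρ := hρc.integrable_of_hasCompactSupport hρs
  have h := integral_convolution (lsmul ℝ ℝ) (μ := (volume : Measure E)) hint hGp
  rw [hρ1] at h
  simp only [lsmul_apply, one_smul] at h
  rw [← h]
  exact integral_mono_of_nonneg (Eventually.of_forall fun x => by positivity)
    (hint.integrable_convolution _ hGp)
    (Eventually.of_forall fun x => norm_mollify_rpow_le hp hρc hρs hρ0 hρ1 hG hGp x)

end Mollify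

/-! ### Mollification commutes with the weak gradient. -/

section Weak

open scoped Convolution
open ContinuousLinearMap

variable {n : ℕ}

theorem norm_le_of_apply_single (D : EuclideanSpace ℝ (Fin n) →L[ℝ] ℝ)
    (w : EuclideanSpace ℝ (Fin n)) (h : ∀ i, D (EuclideanSpace.single i 1) = w i) :
    ‖D‖ = ‖w‖ := by
  have : D = innerSL ℝ w := by
    ext v
    have hv : v = ∑ i, v i • EuclideanSpace.single i (1 : ℝ) := by
      ext j
      simp [Pi.single_apply]
    rw [innerSL_apply_apply, PiLp.inner_apply]
    conv_lhs => rw [hv]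
    simp [h]
  rw [this, innerSL_apply_norm]

/-- The derivative falls on `ρ`, and the definition of the weak gradient with test function `t ↦ ρ
(x - t)` moves it to `u`. The minus sign of the definition cancels the one from the inner derivative
of `x - t`. -/
theorem IsWeakGradient.norm_fderiv_mollify {u : EuclideanSpace ℝ (Fin n) → ℝ}
    {G : EuclideanSpace ℝ (Fin n) → EuclideanSpace ℝ (Fin n)} (h : IsWeakGradient u G)
    {ρ : EuclideanSpace ℝ (Fin n) → ℝ} (hρc : ContDiff ℝ ∞ ρ) (hρs : HasCompactSupport ρ)
    (x : EuclideanSpace ℝ (Fin n)) :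
    ‖fderiv ℝ (ρ ⋆[lsmul ℝ ℝ, volume] u) x‖ = ‖(ρ ⋆[lsmul ℝ ℝ, volume] G) x‖ := by
  obtain ⟨hu, hG, hw⟩ := h
  have hρ1 : ContDiff ℝ 1 ρ := hρc.of_le (by exact_mod_cast le_top)
  have hρd : Differentiable ℝ ρ := hρ1.differentiable (by simp)
  have hex1 := ((hρs.fderiv (𝕜 := ℝ)).convolutionExists_left ((lsmul ℝ ℝ).precompL (EuclideanSpace ℝ (Fin n)))
    (hρ1.continuous_fderiv (by simp)) hu x).integrable_swap
  have hex2 := (hρs.convolutionExists_left (lsmul ℝ ℝ) hρc.continuous hG x).integrable_swap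
  refine norm_le_of_apply_single _ _ fun i => ?_
  rw [(hρs.hasFDerivAt_convolution_left (lsmul ℝ ℝ) hρ1 hu x).fderiv, convolution_eq_swap,
    convolution_eq_swap, ContinuousLinearMap.integral_apply hex1]
  have hpr := ContinuousLinearMap.integral_comp_comm (EuclideanSpace.proj (𝕜 := ℝ) i) hex2
  refine Eq.trans ?_ hpr
  have hφ : ContDiff ℝ ∞ fun t => ρ (x - t) := hρc.comp (contDiff_const.sub contDiff_id)
  have hφs : HasCompactSupport fun t => ρ (x - t) :=
    hρs.comp_homeomorph (Homeomorph.subLeft x)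
  have := hw _ hφ hφs i
  have hder : ∀ t, fderiv ℝ (fun t => ρ (x - t)) t = -fderiv ℝ ρ (x - t) := by
    intro t
    have h1 := ((hρd (x - t)).hasFDerivAt).comp t ((hasFDerivAt_id t).const_sub x)
    refine h1.fderiv.trans ?_
    ext v
    simp
  simp only [hder] at this
  simp only [_root_.neg_apply, mul_neg, integral_neg, neg_inj] at this
  simp only [precompL_apply, lsmul_apply, smul_eq_mul, PiLp.proj_apply, PiLp.smul_apply]
  rw [show (fun a => (fderiv ℝ ρ (x - a)) (EuclideanSpace.single i 1) * u a) =
    fun a => u a * (fderiv ℝ ρ (x - a)) (EuclideanSpace.single i 1) from funext fun a => mul_comm _ _,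
    this]
  exact integral_congr_ae (Eventually.of_forall fun a => mul_comm _ _)

end Weak

/-! ### From test functions to Sobolev functions -/

section Sobolev

open scoped Convolution
open ContinuousLinearMap

variable {n : ℕ}

theorem integrable_norm_rpow_of_memLp {X F : Type*} [MeasurableSpace X] {μ : Measure X}
    [NormedAddCommGroup F] {p : ℝ} (hp : 0 < p) {u : X → F} (h : MemLp u (ENNReal.ofReal p) μ) :
    Integrable (fun x => ‖u x‖ ^ p) μ := by
  have := h.integrable_norm_rpow (by simpa using hp) ENNReal.ofReal_ne_top
  rwa [ENNReal.toReal_ofReal hp.le] at this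

/-- Fatou gives the lower bound and `hle` the upper one, so no dominating function is required. This
suits mollifications, whose `L^p` norms do not exceed that of the original function. -/
theorem tendsto_integral_of_le_of_tendsto {X : Type*} [MeasurableSpace X] {μ : Measure X}
    {f : X → ℝ} {g : ℕ → X → ℝ} (hf : Integrable f μ) (hf0 : ∀ x, 0 ≤ f x)
    (hg : ∀ k, Integrable (g k) μ) (hg0 : ∀ k x, 0 ≤ g k x)
    (hle : ∀ k, ∫ x, g k x ∂μ ≤ ∫ x, f x ∂μ)
    (hlim : ∀ᵐ x ∂μ, Tendsto (fun k => g k x) atTop (𝓝 (f x))) :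
    Tendsto (fun k => ∫ x, g k x ∂μ) atTop (𝓝 (∫ x, f x ∂μ)) := by
  have hF : ENNReal.ofReal (∫ x, f x ∂μ) ≤
      liminf (fun k => ENNReal.ofReal (∫ x, g k x ∂μ)) atTop := by
    calc ENNReal.ofReal (∫ x, f x ∂μ) = ∫⁻ x, ENNReal.ofReal (f x) ∂μ :=
          ofReal_integral_eq_lintegral_ofReal hf (Eventually.of_forall hf0)
      _ ≤ ∫⁻ x, liminf (fun k => ENNReal.ofReal (g k x)) atTop ∂μ :=
          lintegral_mono_ae (hlim.mono fun x hx =>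
            ((ENNReal.continuous_ofReal.tendsto _).comp hx).liminf_eq.ge)
      _ ≤ liminf (fun k => ∫⁻ x, ENNReal.ofReal (g k x) ∂μ) atTop :=
          lintegral_liminf_le' fun k => (hg k).aestronglyMeasurable.aemeasurable.ennreal_ofReal
      _ = _ := by
          congr 1
          ext k
          rw [ofReal_integral_eq_lintegral_ofReal (hg k) (Eventually.of_forall (hg0 k))]
  have hS : limsup (fun k => ENNReal.ofReal (∫ x, g k x ∂μ)) atTop ≤
      ENNReal.ofReal (∫ x, f x ∂μ) :=
    limsup_le_of_le (by isBoundedDefault)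
      (Eventually.of_forall fun k => ENNReal.ofReal_le_ofReal (hle k))
  have h := (ENNReal.continuousAt_toReal ENNReal.ofReal_ne_top).tendsto.comp
    (tendsto_of_le_liminf_of_limsup_le hF hS)
  rw [ENNReal.toReal_ofReal (integral_nonneg hf0)] at h
  refine h.congr fun k => ?_
  simp only [Function.comp]
  exact ENNReal.toReal_ofReal (integral_nonneg (hg0 k))

/-- The bumps of radius `1 / (k + 1)`. -/
def mollifier (n k : ℕ) : ContDiffBump (0 : EuclideanSpace ℝ (Fin n)) where
  rIn := 1 / (2 * ((k : ℝ) + 1))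
  rOut := 1 / ((k : ℝ) + 1)
  rIn_pos := by positivity
  rIn_lt_rOut := by
    rw [div_lt_div_iff_of_pos_left one_pos (by positivity) (by positivity)]
    linarith [(Nat.cast_nonneg k : (0 : ℝ) ≤ k)]

/-- Mollifications are test functions whose Dirichlet integral is at most that of `u`. All of them
live in one ball, where the negative part of the entropy density is at most `1`; this dominates the
negative parts. -/
theorem EntropyBound.of_hasCompactSupport {p A : ℝ} (hn : 0 < n) (hp : 1 ≤ p) (hA : 0 ≤ A)
    (hsm : ∀ φ : EuclideanSpace ℝ (Fin n) → ℝ, ContDiff ℝ ∞ φ → HasCompactSupport φ →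
      0 < ∫ x, |φ x| ^ p → EntropyBound n p A volume φ (∫ x, ‖fderiv ℝ φ x‖ ^ p))
    {u : EuclideanSpace ℝ (Fin n) → ℝ} {G : EuclideanSpace ℝ (Fin n) → EuclideanSpace ℝ (Fin n)}
    (h : MemSobolevEuclidean p u G) (hu : HasCompactSupport u) (hu0 : 0 < ∫ x, |u x| ^ p) :
    EntropyBound n p A volume u (∫ x, ‖G x‖ ^ p) := by
  obtain ⟨hup, hGp, hw⟩ := h
  have hp0 : 0 < p := by linarith
  set ρ : ℕ → EuclideanSpace ℝ (Fin n) → ℝ := fun k => (mollifier n k).normed volume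
  set v : ℕ → EuclideanSpace ℝ (Fin n) → ℝ := fun k => ρ k ⋆[lsmul ℝ ℝ, volume] u
  have hρc : ∀ k, ContDiff ℝ ∞ (ρ k) := fun k => (mollifier n k).contDiff_normed
  have hρs : ∀ k, HasCompactSupport (ρ k) := fun k => (mollifier n k).hasCompactSupport_normed
  have hρ0 : ∀ k x, 0 ≤ ρ k x := fun k => (mollifier n k).nonneg_normed
  have hρ1 : ∀ k, ∫ x, ρ k x = 1 := fun k => (mollifier n k).integral_normed
  have hvc : ∀ k, ContDiff ℝ ∞ (v k) := fun k => (hρs k).contDiff_convolution_left _ (hρc k) hw.1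
  have hvs : ∀ k, HasCompactSupport (v k) := fun k => (hρs k).convolution _ hu
  have hui := integrable_norm_rpow_of_memLp hp0 hup
  have hGi := integrable_norm_rpow_of_memLp hp0 hGp
  simp only [Real.norm_eq_abs] at hui
  have hvi : ∀ k, Integrable fun x => |v k x| ^ p := fun k =>
    ((hvc k).continuous.abs.rpow_const fun _ => Or.inr hp0.le).integrable_of_hasCompactSupport
      ((hvs k).comp_left (g := fun t : ℝ => |t| ^ p) (by simp [hp0.ne']))
  have hlim : ∀ᵐ x, Tendsto (fun k => v k x) atTop (𝓝 (u x)) := by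
    -- `K` is the fixed ratio of the outer to the inner radius of the bumps.
    refine ContDiffBump.ae_convolution_tendsto_right_of_locallyIntegrable (K := 2) ?_ ?_ hw.1
    · exact tendsto_one_div_add_atTop_nhds_zero_nat
    · refine Eventually.of_forall fun k => le_of_eq ?_
      change 1 / ((k : ℝ) + 1) = 2 * (1 / (2 * ((k : ℝ) + 1)))
      field_simp
  have hlimp : ∀ᵐ x, Tendsto (fun k => |v k x| ^ p) atTop (𝓝 (|u x| ^ p)) :=
    hlim.mono fun x hx => hx.abs.rpow_const (Or.inr hp0.le)
  have hm := tendsto_integral_of_le_of_tendsto hui (fun x => by positivity) hvi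
    (fun k x => by positivity) (fun k => by
      simpa only [Real.norm_eq_abs] using integral_norm_mollify_rpow_le hp (hρc k).continuous (hρs k) (hρ0 k)
        (hρ1 k) hw.1 (by simpa only [Real.norm_eq_abs] using hui)) hlimp
  -- The mollifications have positive mass only from some index on, hence the shift by `N` below.
  obtain ⟨N, hN⟩ := eventually_atTop.1 (hm.eventually (lt_mem_nhds hu0))
  have hΓ : ∀ k, ∫ x, ‖fderiv ℝ (v k) x‖ ^ p ≤ ∫ x, ‖G x‖ ^ p := by
    intro k
    simp only [v, hw.norm_fderiv_mollify (hρc k) (hρs k)]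
    exact integral_norm_mollify_rpow_le hp (hρc k).continuous (hρs k) (hρ0 k) (hρ1 k) hw.2.1 hGi
  obtain ⟨R, hR⟩ := hu.isCompact.isBounded.subset_closedBall (0 : EuclideanSpace ℝ (Fin n))
  have hcont := continuous_entDensity_real hp0
  -- The mollifiers have radius at most `1`.
  set K := Metric.closedBall (0 : EuclideanSpace ℝ (Fin n)) (R + 1)
  have hK : volume K < ⊤ := measure_closedBall_lt_top
  have hzero : ∀ k x, x ∉ K → v k x = 0 := by
    intro k x hx
    by_contra hne
    obtain ⟨a, ha, b, hb, hab⟩ := Set.mem_add.1 (support_convolution_subset (lsmul ℝ ℝ) hne)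
    have ha' : ‖a‖ < 1 := by
      have : a ∈ Metric.ball (0 : EuclideanSpace ℝ (Fin n)) (mollifier n k).rOut := by
        rw [← (mollifier n k).support_normed_eq (μ := volume)]
        exact ha
      rw [mem_ball_zero_iff] at this
      refine this.trans_le ?_
      change 1 / ((k : ℝ) + 1) ≤ 1
      rw [div_le_one (by positivity)]
      linarith [(Nat.cast_nonneg k : (0 : ℝ) ≤ k)]
    have hb' : ‖b‖ ≤ R := by simpa using hR (subset_tsupport _ hb)
    apply hx
    rw [mem_closedBall_zero_iff, ← hab]
    linarith [norm_add_le a b]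
  have hneg1 : ∀ k x, ‖max (-(entDensity p (v k) x)) 0‖ ≤ K.indicator (fun _ => (1 : ℝ)) x := by
    intro k x
    rw [Real.norm_of_nonneg (le_max_right _ _)]
    by_cases hx : x ∈ K
    · rw [indicator_of_mem hx]
      exact max_le (neg_mul_log_le_one (by positivity)) zero_le_one
    · rw [indicator_of_notMem hx]
      simp [entDensity, hzero k x hx, hp0.ne']
  have hKi : Integrable (K.indicator fun _ => (1 : ℝ)) :=
    (integrable_indicator_iff measurableSet_closedBall).2 (integrableOn_const hK.ne)
  have hum : AEMeasurable u := hup.1.aemeasurable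
  have humax : AEStronglyMeasurable (fun x => max (-(entDensity p u x)) 0) volume :=
    ((hcont.measurable.comp_aemeasurable hum).neg.max aemeasurable_const).aestronglyMeasurable
  have hvmax : ∀ k, Continuous fun x => max (-(entDensity p (v k) x)) 0 := fun k =>
    (hcont.comp (hvc k).continuous).neg.max continuous_const
  have hlimmax : ∀ᵐ x, Tendsto (fun k => max (-(entDensity p (v k) x)) 0) atTop
      (𝓝 (max (-(entDensity p u x)) 0)) := hlim.mono fun x hx =>
    (((hcont.tendsto (u x)).comp hx).neg).max tendsto_const_nhds
  have hneg : Integrable fun x => max (-(entDensity p u x)) 0 := by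
    refine hKi.mono' humax (hlimmax.mono fun x hx => ?_)
    exact le_of_tendsto' hx.norm fun k => hneg1 k x
  have hshift := tendsto_add_atTop_nat N
  refine EntropyBound.of_tendsto (v := fun k => v (k + N)) (γ := fun _ => ∫ x, ‖G x‖ ^ p)
    (by exact_mod_cast hn) hp0
    (fun k => (hsm _ (hvc _) (hvs _) (hN _ (Nat.le_add_left _ _))).mono hA (hΓ _)
      (hN _ (Nat.le_add_left _ _)))
    (fun k => (hvc _).continuous.aemeasurable) hum (hlim.mono fun x hx => hx.comp hshift)
    (fun k => hN _ (Nat.le_add_left _ _)) hu0 (hm.comp hshift) hneg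
    ((tendsto_integral_of_dominated_convergence _ (fun k => (hvmax k).aestronglyMeasurable) hKi
      (fun k => Eventually.of_forall (hneg1 k)) hlimmax).comp hshift) tendsto_const_nhds

end Sobolev

/-! ### Removing the compact support by cutoff functions. -/

section Cutoff

variable {n : ℕ}

/-- The product rule, obtained by testing the weak gradient of `u` against `χ φ`. -/
theorem IsWeakGradient.smul {u : EuclideanSpace ℝ (Fin n) → ℝ}
    {G : EuclideanSpace ℝ (Fin n) → EuclideanSpace ℝ (Fin n)} (h : IsWeakGradient u G)
    {χ : EuclideanSpace ℝ (Fin n) → ℝ} (hχ : ContDiff ℝ ∞ χ) :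
    IsWeakGradient (fun x => χ x * u x)
      (fun x => χ x • G x + u x • (InnerProductSpace.toDual ℝ _).symm (fderiv ℝ χ x)) := by
  obtain ⟨hu, hG, hw⟩ := h
  have hdχ : Continuous (fderiv ℝ χ) := hχ.continuous_fderiv (by simp)
  have hgrad : Continuous fun x => (InnerProductSpace.toDual ℝ _).symm (fderiv ℝ χ x) :=
    (InnerProductSpace.toDual ℝ _).symm.continuous.comp hdχ
  refine ⟨?_, ?_, ?_⟩
  · rw [← locallyIntegrableOn_univ] at hu ⊢
    exact hu.continuousOn_smul isOpen_univ.isLocallyClosed hχ.continuous.continuousOn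
  · refine LocallyIntegrable.add ?_ ?_
    · rw [← locallyIntegrableOn_univ] at hG ⊢
      exact hG.continuousOn_smul isOpen_univ.isLocallyClosed hχ.continuous.continuousOn
    · rw [← locallyIntegrableOn_univ] at hu ⊢
      exact hu.smul_continuousOn isOpen_univ.isLocallyClosed hgrad.continuousOn
  · intro φ hφ hφs i
    have hdφ : Continuous (fderiv ℝ φ) := hφ.continuous_fderiv (by simp)
    have hχd : Differentiable ℝ χ := hχ.differentiable (by simp)
    have hφd : Differentiable ℝ φ := hφ.differentiable (by simp)
    have key := hw (fun x => χ x * φ x) (hχ.mul hφ) hφs.mul_left i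
    have hfd : ∀ x, fderiv ℝ (fun x => χ x * φ x) x (EuclideanSpace.single i 1) =
        χ x * fderiv ℝ φ x (EuclideanSpace.single i 1) +
          φ x * fderiv ℝ χ x (EuclideanSpace.single i 1) := by
      intro x
      rw [fderiv_fun_mul (hχd x) (hφd x)]
      simp
    have hgi : ∀ x, ((InnerProductSpace.toDual ℝ _).symm (fderiv ℝ χ x)) i =
        fderiv ℝ χ x (EuclideanSpace.single i 1) := by
      intro x
      rw [← InnerProductSpace.toDual_symm_apply (𝕜 := ℝ), EuclideanSpace.inner_single_right]
      simp
    have hGi : LocallyIntegrable fun x => G x i := fun x =>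
      (EuclideanSpace.proj (𝕜 := ℝ) i).integrableAtFilter_comp (hG x)
    have i1 : Integrable fun x => u x * (χ x * fderiv ℝ φ x (EuclideanSpace.single i 1)) :=
      hu.integrable_smul_right_of_hasCompactSupport
        (hχ.continuous.mul (hdφ.clm_apply continuous_const))
        ((hφs.fderiv_apply (𝕜 := ℝ) _).mul_left)
    have i2 : Integrable fun x => u x * (φ x * fderiv ℝ χ x (EuclideanSpace.single i 1)) :=
      hu.integrable_smul_right_of_hasCompactSupport
        (hφ.continuous.mul (hdχ.clm_apply continuous_const)) hφs.mul_right
    have i3 : Integrable fun x => G x i * (χ x * φ x) :=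
      hGi.integrable_smul_right_of_hasCompactSupport (hχ.continuous.mul hφ.continuous) hφs.mul_left
    simp only [hfd, mul_add] at key
    rw [integral_add i1 i2] at key
    have e1 : ∀ x, χ x * u x * fderiv ℝ φ x (EuclideanSpace.single i 1) =
      u x * (χ x * fderiv ℝ φ x (EuclideanSpace.single i 1)) := fun x => by ring
    have e2 : ∀ x, (χ x • G x + u x • (InnerProductSpace.toDual ℝ _).symm (fderiv ℝ χ x)) i * φ x =
        G x i * (χ x * φ x) + u x * (φ x * fderiv ℝ χ x (EuclideanSpace.single i 1)) := by
      intro x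
      simp only [PiLp.add_apply, PiLp.smul_apply, smul_eq_mul, hgi]
      ring
    simp only [e1, e2]
    rw [integral_add i3 i2]
    linarith

/-- The smooth cutoff functions, equal to `1` on the ball of radius `k + 1` and vanishing off the
ball of radius `2 (k + 1)`. -/
def cutoff (n k : ℕ) (x : EuclideanSpace ℝ (Fin n)) : ℝ :=
  (⟨1, 2, one_pos, one_lt_two⟩ : ContDiffBump (0 : EuclideanSpace ℝ (Fin n)))
    (((k : ℝ) + 1)⁻¹ • x)

theorem contDiff_cutoff (k : ℕ) : ContDiff ℝ ∞ (cutoff n k) :=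
  (ContDiffBump.contDiff _).comp (contDiff_const_smul _)

theorem cutoff_nonneg (k : ℕ) (x : EuclideanSpace ℝ (Fin n)) : 0 ≤ cutoff n k x :=
  ContDiffBump.nonneg _

theorem cutoff_le_one (k : ℕ) (x : EuclideanSpace ℝ (Fin n)) : cutoff n k x ≤ 1 :=
  ContDiffBump.le_one _

theorem hasCompactSupport_cutoff (k : ℕ) : HasCompactSupport (cutoff n k) :=
  (ContDiffBump.hasCompactSupport _).comp_smul (by positivity)

/-- Equality of germs, not just of values, so that the derivative of the cutoff at `x` eventually
vanishes too. -/
theorem eventually_cutoff_eq_one (x : EuclideanSpace ℝ (Fin n)) :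
    ∀ᶠ k : ℕ in atTop, cutoff n k =ᶠ[𝓝 x] fun _ => 1 := by
  obtain ⟨K, hK⟩ := exists_nat_gt ‖x‖
  filter_upwards [eventually_ge_atTop K] with k hk
  have hk' : (K : ℝ) ≤ k := by exact_mod_cast hk
  have : ∀ᶠ y in 𝓝 x, ‖y‖ < K := continuous_norm.continuousAt.eventually_lt_const hK
  filter_upwards [this] with y hy
  refine ContDiffBump.one_of_mem_closedBall _ ?_
  rw [mem_closedBall_zero_iff, norm_smul, norm_inv, Real.norm_of_nonneg (by positivity),
    inv_mul_le_one₀ (by positivity)]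
  linarith

theorem exists_norm_fderiv_cutoff_le (n : ℕ) :
    ∃ C, 0 ≤ C ∧ ∀ (k : ℕ) (x : EuclideanSpace ℝ (Fin n)), ‖fderiv ℝ (cutoff n k) x‖ ≤ C := by
  set f : ContDiffBump (0 : EuclideanSpace ℝ (Fin n)) := ⟨1, 2, one_pos, one_lt_two⟩
  have hf : ContDiff ℝ 1 f := f.contDiff
  obtain ⟨C, hC⟩ := (hf.continuous_fderiv (by simp)).bounded_above_of_compact_support
    (f.hasCompactSupport.fderiv (𝕜 := ℝ))
  refine ⟨C, (norm_nonneg _).trans (hC 0), fun k x => ?_⟩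
  have : cutoff n k = fun x => f (((k : ℝ) + 1)⁻¹ • x) := rfl
  rw [this, fderiv_comp_smul, norm_smul, norm_inv, Real.norm_of_nonneg (by positivity)]
  refine le_trans (mul_le_of_le_one_left (norm_nonneg _) ?_) (hC _)
  exact inv_le_one_of_one_le₀ (by linarith [(Nat.cast_nonneg k : (0 : ℝ) ≤ k)])

/-- Mass and Dirichlet integral of the truncations converge by domination. For the negative parts
the dominating function is the negative part of `u` plus `|u|^p`, by `negPart_mul_log_damp` with `c
= cutoff^p`. -/
theorem EntropyBound.of_memSobolev {p A : ℝ} (hn : 0 < n) (hp : 1 ≤ p) (hA : 0 ≤ A)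
    (hsm : ∀ φ : EuclideanSpace ℝ (Fin n) → ℝ, ContDiff ℝ ∞ φ → HasCompactSupport φ →
      0 < ∫ x, |φ x| ^ p → EntropyBound n p A volume φ (∫ x, ‖fderiv ℝ φ x‖ ^ p))
    {u : EuclideanSpace ℝ (Fin n) → ℝ} {G : EuclideanSpace ℝ (Fin n) → EuclideanSpace ℝ (Fin n)}
    (h : MemSobolevEuclidean p u G) (hu0 : 0 < ∫ x, |u x| ^ p)
    (hneg : Integrable fun x => max (-(entDensity p u x)) 0) :
    EntropyBound n p A volume u (∫ x, ‖G x‖ ^ p) := by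
  obtain ⟨hup, hGp, hw⟩ := h
  have hp0 : 0 < p := by linarith
  have hui := integrable_norm_rpow_of_memLp hp0 hup
  simp only [Real.norm_eq_abs] at hui
  have hum : AEMeasurable u := hup.1.aemeasurable
  have hcont := continuous_entDensity_real hp0
  obtain ⟨C, hC0, hC⟩ := exists_norm_fderiv_cutoff_le n
  set D : ℕ → EuclideanSpace ℝ (Fin n) → EuclideanSpace ℝ (Fin n) := fun k x =>
    (InnerProductSpace.toDual ℝ _).symm (fderiv ℝ (cutoff n k) x)
  have hDn : ∀ k x, ‖D k x‖ ≤ C := fun k x => by simpa [D] using hC k x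
  have hDc : ∀ k, Continuous (D k) := fun k => (InnerProductSpace.toDual ℝ _).symm.continuous.comp
    ((contDiff_cutoff k).continuous_fderiv (by simp))
  set v : ℕ → EuclideanSpace ℝ (Fin n) → ℝ := fun k x => cutoff n k x * u x
  set W : ℕ → EuclideanSpace ℝ (Fin n) → EuclideanSpace ℝ (Fin n) := fun k x =>
    cutoff n k x • G x + u x • D k x
  have habs : ∀ k x, |v k x| ≤ |u x| := fun k x => by
    simp only [v, abs_mul, abs_of_nonneg (cutoff_nonneg k x)]
    exact mul_le_of_le_one_left (abs_nonneg _) (cutoff_le_one k x)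
  have hWn : ∀ k x, ‖W k x‖ ≤ ‖G x‖ + C * |u x| := fun k x => by
    refine (norm_add_le _ _).trans (add_le_add ?_ ?_)
    · rw [norm_smul, Real.norm_of_nonneg (cutoff_nonneg k x)]
      exact mul_le_of_le_one_left (norm_nonneg _) (cutoff_le_one k x)
    · rw [norm_smul, Real.norm_eq_abs, mul_comm]
      exact mul_le_mul_of_nonneg_right (hDn k x) (abs_nonneg _)
  have hvm : ∀ k, AEStronglyMeasurable (v k) volume := fun k =>
    (contDiff_cutoff k).continuous.aestronglyMeasurable.mul hup.1
  have hWm : ∀ k, AEStronglyMeasurable (W k) volume := fun k =>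
    ((contDiff_cutoff k).continuous.aestronglyMeasurable.smul hGp.1).add
      (hup.1.smul (hDc k).aestronglyMeasurable)
  have hdom : MemLp (fun x => ‖G x‖ + C * |u x|) (ENNReal.ofReal p) :=
    hGp.norm.add (hup.norm.const_mul C)
  have hvp : ∀ k, MemLp (v k) (ENNReal.ofReal p) := fun k =>
    hup.mono (hvm k) (Eventually.of_forall fun x => by simpa using habs k x)
  have hWp : ∀ k, MemLp (W k) (ENNReal.ofReal p) := fun k =>
    hdom.mono (hWm k) (Eventually.of_forall fun x => (hWn k x).trans (le_abs_self _))
  have hvS : ∀ k, MemSobolevEuclidean p (v k) (W k) := fun k =>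
    ⟨hvp k, hWp k, hw.smul (contDiff_cutoff k)⟩
  have hlim : ∀ x, ∀ᶠ k in atTop, v k x = u x ∧ W k x = G x := by
    intro x
    filter_upwards [eventually_cutoff_eq_one x] with k hk
    have h1 := hk.eq_of_nhds
    have h2 : D k x = 0 := by simp [D, hk.fderiv_eq]
    simp [v, W, h1, h2]
  have hlimv : ∀ x, Tendsto (fun k => v k x) atTop (𝓝 (u x)) := fun x =>
    tendsto_const_nhds.congr' ((hlim x).mono fun k hk => hk.1.symm)
  have hm : Tendsto (fun k => ∫ x, |v k x| ^ p) atTop (𝓝 (∫ x, |u x| ^ p)) := by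
    refine tendsto_integral_of_dominated_convergence _ (fun k => ?_) hui
      (fun k => Eventually.of_forall fun x => ?_) (Eventually.of_forall fun x =>
        (hlimv x).abs.rpow_const (Or.inr hp0.le))
    · exact ((hvm k).aemeasurable.abs.pow_const p).aestronglyMeasurable
    · rw [Real.norm_of_nonneg (by positivity)]
      exact Real.rpow_le_rpow (abs_nonneg _) (habs k x) hp0.le
  have hΓ : Tendsto (fun k => ∫ x, ‖W k x‖ ^ p) atTop (𝓝 (∫ x, ‖G x‖ ^ p)) := by
    have hdi := integrable_norm_rpow_of_memLp hp0 hdom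
    refine tendsto_integral_of_dominated_convergence _ (fun k => ?_) hdi
      (fun k => Eventually.of_forall fun x => ?_) (Eventually.of_forall fun x =>
        tendsto_const_nhds.congr' ((hlim x).mono fun k hk => by simp only [hk.2]))
    · exact ((hWm k).norm.aemeasurable.pow_const p).aestronglyMeasurable
    · rw [Real.norm_of_nonneg (by positivity)]
      exact Real.rpow_le_rpow (norm_nonneg _) ((hWn k x).trans (le_abs_self _)) hp0.le
  have hN : Tendsto (fun k => ∫ x, max (-(entDensity p (v k) x)) 0) atTop
      (𝓝 (∫ x, max (-(entDensity p u x)) 0)) := by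
    refine tendsto_integral_of_dominated_convergence _ (fun k => ?_) (hneg.add hui)
      (fun k => Eventually.of_forall fun x => ?_) (Eventually.of_forall fun x =>
        (((hcont.tendsto (u x)).comp (hlimv x)).neg).max tendsto_const_nhds)
    · exact ((hcont.measurable.comp_aemeasurable (hvm k).aemeasurable).neg.max
        aemeasurable_const).aestronglyMeasurable
    · rw [Real.norm_of_nonneg (le_max_right _ _)]
      have h1 : |v k x| ^ p = cutoff n k x ^ p * |u x| ^ p := by
        simp only [v, abs_mul, abs_of_nonneg (cutoff_nonneg k x)]
        exact Real.mul_rpow (cutoff_nonneg k x) (abs_nonneg _)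
      simp only [entDensity, h1, Pi.add_apply]
      exact negPart_mul_log_damp (Real.rpow_nonneg (cutoff_nonneg k x) p)
        (Real.rpow_le_one (cutoff_nonneg k x) (cutoff_le_one k x) hp0.le) (by positivity)
  obtain ⟨N, hN0⟩ := eventually_atTop.1 (hm.eventually (lt_mem_nhds hu0))
  have hshift := tendsto_add_atTop_nat N
  exact EntropyBound.of_tendsto (v := fun k => v (k + N)) (γ := fun k => ∫ x, ‖W (k + N) x‖ ^ p)
    (by exact_mod_cast hn) hp0
    (fun k => EntropyBound.of_hasCompactSupport hn hp hA hsm (hvS _)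
      (hasCompactSupport_cutoff _).mul_right (hN0 _ (Nat.le_add_left _ _)))
    (fun k => (hvm _).aemeasurable) hum (Eventually.of_forall fun x => (hlimv x).comp hshift)
    (fun k => hN0 _ (Nat.le_add_left _ _)) hu0 (hm.comp hshift) hneg (hN.comp hshift)
    (hΓ.comp hshift)

theorem EuclideanEntropyInequality.of_test {p A : ℝ} (hn : 0 < n) (hp : 1 ≤ p) (hA : 0 ≤ A)
    (hsm : ∀ φ : EuclideanSpace ℝ (Fin n) → ℝ, ContDiff ℝ ∞ φ → HasCompactSupport φ →
      0 < ∫ x, |φ x| ^ p → EntropyBound n p A volume φ (∫ x, ‖fderiv ℝ φ x‖ ^ p)) :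
    EuclideanEntropyInequality n p A := by
  intro u G h h1
  have hp0 : 0 < p := by linarith
  have hn' : (0 : ℝ) < n := by exact_mod_cast hn
  by_cases hinf : ∫⁻ x, ENNReal.ofReal (-(entDensity p u x)) = ⊤
  · rw [entropy_eq_bot hinf]
    exact bot_le
  have hneg : Integrable fun x => max (-(entDensity p u x)) 0 := by
    refine ⟨(((continuous_entDensity_real hp0).measurable.comp_aemeasurable
      h.1.1.aemeasurable).neg.max aemeasurable_const).aestronglyMeasurable, ?_⟩
    rw [hasFiniteIntegral_iff_ofReal (Eventually.of_forall fun x => by exact le_max_right _ _)]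
    simpa [ENNReal.ofReal_max] using lt_top_iff_ne_top.2 hinf
  have hb := EntropyBound.of_memSobolev hn hp hA hsm h (h1 ▸ one_pos) hneg
  have hbd := hb.bound
  rw [h1, Real.log_one, div_one, div_one, sub_zero] at hbd
  have hpos := (Real.exp_pos _).trans_le hbd
  rw [entropy_eq_of_integrable hb.integrable, logBound, ENNReal.log_ofReal_of_pos hpos,
    ← EReal.coe_mul, EReal.coe_le_coe_iff]
  rw [← Real.le_log_iff_exp_le hpos] at hbd
  calc ∫ x, entDensity p u x = n / p * (p / n * ∫ x, entDensity p u x) := by field_simp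
    _ ≤ _ := mul_le_mul_of_nonneg_left hbd (by positivity)

end Cutoff

/-! ### The Riemannian volume in a chart -/

section Volume

variable {n : ℕ} {M : Type*} [TopologicalSpace M] [ChartedSpace (EuclideanSpace ℝ (Fin n)) M]
  [IsManifold (𝓡 n) ∞ M]

/-- The metric at `q`, as a bilinear form on the model space. -/
def metricForm (g : Metric n M) (q : M) :
    EuclideanSpace ℝ (Fin n) →L[ℝ] EuclideanSpace ℝ (Fin n) →L[ℝ] ℝ := g.inner q

/-- The derivative of the inverse of the preferred chart at `x`. -/
def chartSymmDeriv (x : M) (y : EuclideanSpace ℝ (Fin n)) :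
    EuclideanSpace ℝ (Fin n) →L[ℝ] EuclideanSpace ℝ (Fin n) :=
  mfderiv (𝓡 n) (𝓡 n) (chartAt (EuclideanSpace ℝ (Fin n)) x).symm y

/-- The transition map from the preferred chart at `x` to the one at `x'`. -/
def transition (x x' : M) (y : EuclideanSpace ℝ (Fin n)) : EuclideanSpace ℝ (Fin n) :=
  chartAt (EuclideanSpace ℝ (Fin n)) x' ((chartAt (EuclideanSpace ℝ (Fin n)) x).symm y)

theorem gramMatrix_apply (g : Metric n M) (x : M) (y : EuclideanSpace ℝ (Fin n)) (i j : Fin n) :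
    gramMatrix g x y i j = metricForm g ((chartAt (EuclideanSpace ℝ (Fin n)) x).symm y)
      (chartSymmDeriv x y (EuclideanSpace.single i 1))
      (chartSymmDeriv x y (EuclideanSpace.single j 1)) := rfl

theorem mdifferentiableAt_transition {x x' : M} {y : EuclideanSpace ℝ (Fin n)}
    (hy : y ∈ (chartAt (EuclideanSpace ℝ (Fin n)) x).target)
    (hy' : (chartAt (EuclideanSpace ℝ (Fin n)) x).symm y ∈
      (chartAt (EuclideanSpace ℝ (Fin n)) x').source) :
    MDifferentiableAt (𝓡 n) (𝓡 n) (transition x x') y := by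
  have : IsManifold (𝓡 n) 1 M := IsManifold.of_le (n := ∞) (by exact_mod_cast le_top)
  exact (mdifferentiableAt_atlas (chart_mem_atlas _ x') hy').comp y
    (mdifferentiableAt_atlas_symm (chart_mem_atlas _ x) hy)

theorem chartSymmDeriv_eq_comp {x x' : M} {y : EuclideanSpace ℝ (Fin n)}
    (hy : y ∈ (chartAt (EuclideanSpace ℝ (Fin n)) x).target)
    (hy' : (chartAt (EuclideanSpace ℝ (Fin n)) x).symm y ∈
      (chartAt (EuclideanSpace ℝ (Fin n)) x').source) :
    chartSymmDeriv x y =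
      (chartSymmDeriv x' (transition x x' y)).comp (fderiv ℝ (transition x x') y) := by
  have : IsManifold (𝓡 n) 1 M := IsManifold.of_le (n := ∞) (by exact_mod_cast le_top)
  have hev : (chartAt (EuclideanSpace ℝ (Fin n)) x).symm =ᶠ[𝓝 y]
      (chartAt (EuclideanSpace ℝ (Fin n)) x').symm ∘ transition x x' := by
    have hopen := ((chartAt (EuclideanSpace ℝ (Fin n)) x).symm.isOpen_inter_preimage
      (chartAt (EuclideanSpace ℝ (Fin n)) x').open_source)
    filter_upwards [hopen.mem_nhds ⟨hy, hy'⟩] with z hz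
    exact ((chartAt (EuclideanSpace ℝ (Fin n)) x').left_inv hz.2).symm
  unfold chartSymmDeriv
  rw [hev.mfderiv_eq, ← mfderiv_eq_fderiv]
  exact mfderiv_comp y (mdifferentiableAt_atlas_symm (chart_mem_atlas _ x')
    ((chartAt (EuclideanSpace ℝ (Fin n)) x').map_source hy')) (mdifferentiableAt_transition hy hy')

/-- A Gram matrix transforms by congruence, `Jᵀ Q J`. -/
theorem det_bilin_comp (Q : EuclideanSpace ℝ (Fin n) →L[ℝ] EuclideanSpace ℝ (Fin n) →L[ℝ] ℝ)
    (D : EuclideanSpace ℝ (Fin n) →L[ℝ] EuclideanSpace ℝ (Fin n)) :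
    (Matrix.of fun i j => Q (D (EuclideanSpace.single i 1)) (D (EuclideanSpace.single j 1))).det =
      D.det ^ 2 * (Matrix.of fun i j : Fin n =>
        Q (EuclideanSpace.single i 1) (EuclideanSpace.single j 1)).det := by
  set b := (EuclideanSpace.basisFun (Fin n) ℝ).toBasis
  set J := LinearMap.toMatrix b b (D : EuclideanSpace ℝ (Fin n) →ₗ[ℝ] EuclideanSpace ℝ (Fin n))
  have hJ : ∀ i, D (EuclideanSpace.single i 1) = ∑ k, J k i • EuclideanSpace.single k (1 : ℝ) := by
    intro i
    ext l
    simp [J, b, LinearMap.toMatrix_apply, Pi.single_apply]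
  have hdet : D.det = J.det := (LinearMap.det_toMatrix b _).symm
  have hmat : (Matrix.of fun i j => Q (D (EuclideanSpace.single i 1)) (D (EuclideanSpace.single j 1)))
      = J.transpose * (Matrix.of fun i j : Fin n =>
        Q (EuclideanSpace.single i 1) (EuclideanSpace.single j 1)) * J := by
    ext i j
    simp only [Matrix.of_apply, hJ, Matrix.mul_apply, Matrix.transpose_apply, map_sum, map_smul,
      _root_.sum_apply, _root_.smul_apply, smul_eq_mul]
    refine Finset.sum_congr rfl fun k _ => ?_
    rw [mul_comm, Finset.sum_mul]
  rw [hmat, Matrix.det_mul, Matrix.det_mul, Matrix.det_transpose, hdet]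
  ring

/-- The volume density `√(det g_{ij})` in the preferred chart at `x`. -/
def chartDensity (g : Metric n M) (x : M) (y : EuclideanSpace ℝ (Fin n)) : ℝ :=
  Real.sqrt (gramMatrix g x y).det

theorem chartDensity_transition (g : Metric n M) {x x' : M} {y : EuclideanSpace ℝ (Fin n)}
    (hy : y ∈ (chartAt (EuclideanSpace ℝ (Fin n)) x).target)
    (hy' : (chartAt (EuclideanSpace ℝ (Fin n)) x).symm y ∈
      (chartAt (EuclideanSpace ℝ (Fin n)) x').source) :
    chartDensity g x y =
      |(fderiv ℝ (transition x x') y).det| * chartDensity g x' (transition x x' y) := by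
  have hq : (chartAt (EuclideanSpace ℝ (Fin n)) x').symm (transition x x' y) =
      (chartAt (EuclideanSpace ℝ (Fin n)) x).symm y :=
    (chartAt (EuclideanSpace ℝ (Fin n)) x').left_inv hy'
  set T := chartSymmDeriv x' (transition x x' y)
  set Q : EuclideanSpace ℝ (Fin n) →L[ℝ] EuclideanSpace ℝ (Fin n) →L[ℝ] ℝ :=
    (metricForm g ((chartAt (EuclideanSpace ℝ (Fin n)) x).symm y)).bilinearComp T T
  have h1 : gramMatrix g x y = Matrix.of fun i j =>
      Q (fderiv ℝ (transition x x') y (EuclideanSpace.single i 1))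
        (fderiv ℝ (transition x x') y (EuclideanSpace.single j 1)) := by
    ext i j
    rw [gramMatrix_apply, chartSymmDeriv_eq_comp hy hy']
    rfl
  have h2 : gramMatrix g x' (transition x x' y) = Matrix.of fun i j =>
      Q (EuclideanSpace.single i 1) (EuclideanSpace.single j 1) := by
    ext i j
    rw [gramMatrix_apply, hq]
    rfl
  unfold chartDensity
  rw [h1, h2, det_bilin_comp, Real.sqrt_mul (sq_nonneg _), Real.sqrt_sq_eq_abs]

variable [MeasurableSpace M] [BorelSpace M]

omit [IsManifold (𝓡 n) ∞ M] in
theorem measurableSet_chart_preimage (x : M) {S : Set M} (hS : MeasurableSet S) :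
    MeasurableSet ((chartAt (EuclideanSpace ℝ (Fin n)) x).symm ⁻¹' S ∩
      (chartAt (EuclideanSpace ℝ (Fin n)) x).target) := by
  have h1 := (chartAt (EuclideanSpace ℝ (Fin n)) x).continuousOn_symm.domRestrict.measurable hS
  have h2 := MeasurableSet.subtype_image
    (chartAt (EuclideanSpace ℝ (Fin n)) x).open_target.measurableSet h1
  convert h2 using 1
  ext y
  simp [and_comm]

omit [IsManifold (𝓡 n) ∞ M] in
theorem aemeasurable_chart_symm (x : M) :
    AEMeasurable (chartAt (EuclideanSpace ℝ (Fin n)) x).symm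
      (volume.restrict (chartAt (EuclideanSpace ℝ (Fin n)) x).target) :=
  (chartAt (EuclideanSpace ℝ (Fin n)) x).continuousOn_symm.aemeasurable
    (chartAt (EuclideanSpace ℝ (Fin n)) x).open_target.measurableSet

theorem chartVolume_apply (g : Metric n M) (x : M) {S : Set M} (hS : MeasurableSet S) :
    chartVolume g x S = ∫⁻ y in (chartAt (EuclideanSpace ℝ (Fin n)) x).symm ⁻¹' S ∩
      (chartAt (EuclideanSpace ℝ (Fin n)) x).target, ENNReal.ofReal (chartDensity g x y) := by
  unfold chartVolume
  rw [Measure.map_apply_of_aemeasurable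
    ((aemeasurable_chart_symm x).mono_ac (withDensity_absolutelyContinuous _ _)) hS,
    withDensity_apply' , Measure.restrict_restrict'
      (chartAt (EuclideanSpace ℝ (Fin n)) x).open_target.measurableSet]
  rfl

/-- Change of variables along the transition map, whose Jacobian is exactly the factor between the
two densities. -/
theorem chartVolume_congr (g : Metric n M) (x x' : M) {S : Set M} (hS : MeasurableSet S)
    (hx : S ⊆ (chartAt (EuclideanSpace ℝ (Fin n)) x).source)
    (hx' : S ⊆ (chartAt (EuclideanSpace ℝ (Fin n)) x').source) :
    chartVolume g x S = chartVolume g x' S := by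
  set c := chartAt (EuclideanSpace ℝ (Fin n)) x
  set c' := chartAt (EuclideanSpace ℝ (Fin n)) x'
  have himg : c'.symm ⁻¹' S ∩ c'.target = transition x x' '' (c.symm ⁻¹' S ∩ c.target) := by
    ext z
    constructor
    · rintro ⟨hz, hzt⟩
      refine ⟨c (c'.symm z), ⟨?_, c.map_source (hx hz)⟩, ?_⟩
      · rw [mem_preimage, c.left_inv (hx hz)]
        exact hz
      · change c' (c.symm (c (c'.symm z))) = z
        rw [c.left_inv (hx hz), c'.right_inv hzt]
    · rintro ⟨y, ⟨hy, hyt⟩, rfl⟩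
      refine ⟨?_, c'.map_source (hx' hy)⟩
      change c'.symm (c' (c.symm y)) ∈ S
      rw [c'.left_inv (hx' hy)]
      exact hy
  rw [chartVolume_apply g x hS, chartVolume_apply g x' hS, himg,
    lintegral_image_eq_lintegral_abs_det_fderiv_mul volume (measurableSet_chart_preimage x hS)
      (f' := fderiv ℝ (transition x x'))]
  · refine setLIntegral_congr_fun (measurableSet_chart_preimage x hS) fun y hy => ?_
    rw [← ENNReal.ofReal_mul (abs_nonneg _), ← chartDensity_transition g hy.2 (hx' hy.1)]
  · intro y hy
    exact ((mdifferentiableAt_transition hy.2 (hx' hy.1)).differentiableAt).hasFDerivAt.hasFDerivWithinAt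
  · intro y hy z hz h
    have h1 := c'.injOn (hx' hy.1) (hx' hz.1) h
    exact c.symm.injOn hy.2 hz.2 h1

theorem chartVolume_eq_zero (g : Metric n M) (x : M) {S : Set M} (hS : MeasurableSet S)
    (hx : Disjoint S (chartAt (EuclideanSpace ℝ (Fin n)) x).source) : chartVolume g x S = 0 := by
  rw [chartVolume_apply g x hS]
  have : (chartAt (EuclideanSpace ℝ (Fin n)) x).symm ⁻¹' S ∩
      (chartAt (EuclideanSpace ℝ (Fin n)) x).target = ∅ := by
    refine eq_empty_of_forall_notMem fun y hy => ?_
    exact disjoint_left.1 hx hy.1 ((chartAt (EuclideanSpace ℝ (Fin n)) x).map_target hy.2)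
  rw [this, Measure.restrict_empty, lintegral_zero_measure]

theorem chartVolume_restrict_source (g : Metric n M) (x : M) :
    (chartVolume g x).restrict (chartAt (EuclideanSpace ℝ (Fin n)) x).source = chartVolume g x := by
  refine Measure.restrict_eq_self_of_ae_mem ?_
  rw [ae_iff]
  exact chartVolume_eq_zero g x
    (chartAt (EuclideanSpace ℝ (Fin n)) x).open_source.measurableSet.compl
    disjoint_compl_left

/-- Because the chart measures agree on overlaps, none of them can exceed the one at `x` on its
domain, and so neither can their supremum. -/
theorem vol_restrict_source (g : Metric n M) (x : M) :
    (vol g).restrict (chartAt (EuclideanSpace ℝ (Fin n)) x).source = chartVolume g x := by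
  set s := (chartAt (EuclideanSpace ℝ (Fin n)) x).source
  have hs : MeasurableSet s := (chartAt (EuclideanSpace ℝ (Fin n)) x).open_source.measurableSet
  have hle : ∀ x', chartVolume g x' ≤ vol g := fun x' => le_iSup (chartVolume g) x'
  -- It suffices to bound each chart measure: inside `s` by that at `x`, outside `s` by `vol g`
  -- itself. Restricting to `s` then kills the second term.
  have hvol : vol g ≤ chartVolume g x + (vol g).restrict sᶜ := by
    refine iSup_le fun x' => Measure.le_iff.2 fun S hS => ?_
    set s' := (chartAt (EuclideanSpace ℝ (Fin n)) x').source
    have hs' : MeasurableSet s' :=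
      (chartAt (EuclideanSpace ℝ (Fin n)) x').open_source.measurableSet
    rw [← measure_inter_add_sdiff S hs, Measure.add_apply, Measure.restrict_apply hS]
    refine add_le_add ?_ ?_
    · rw [← measure_inter_add_sdiff (S ∩ s) hs',
        chartVolume_eq_zero g x' ((hS.inter hs).diff hs') disjoint_sdiff_left, add_zero,
        ← chartVolume_congr g x x' ((hS.inter hs).inter hs')
          (inter_subset_left.trans inter_subset_right) inter_subset_right]
      exact measure_mono (inter_subset_left.trans inter_subset_left)
    · exact hle x' _
  refine le_antisymm ?_ ?_
  · refine (Measure.restrict_mono' (Eventually.of_forall fun _ => id) hvol).trans ?_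
    rw [Measure.restrict_add, Measure.restrict_restrict hs, inter_compl_self,
      Measure.restrict_empty, add_zero, chartVolume_restrict_source]
  · rw [← chartVolume_restrict_source]
    exact Measure.restrict_mono' (Eventually.of_forall fun _ => id) (hle x)

end Volume

/-! ### The metric in a chart -/

section ChartMetric

variable {n : ℕ} {M : Type*} [TopologicalSpace M] [ChartedSpace (EuclideanSpace ℝ (Fin n)) M]
  [IsManifold (𝓡 n) ∞ M]

omit [IsManifold (𝓡 n) ∞ M] in
theorem chartSymmDeriv_eq_symmL [IsManifold (𝓡 n) 1 M] {x : M} {y : EuclideanSpace ℝ (Fin n)}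
    (hy : y ∈ (chartAt (EuclideanSpace ℝ (Fin n)) x).target) :
    chartSymmDeriv x y = (trivializationAt (EuclideanSpace ℝ (Fin n))
      (TangentSpace (𝓡 n)) x).symmL ℝ ((chartAt (EuclideanSpace ℝ (Fin n)) x).symm y) := by
  rw [TangentBundle.symmL_trivializationAt
    ((chartAt (EuclideanSpace ℝ (Fin n)) x).map_target hy)]
  simp only [modelWithCornersSelf_coe, range_id, mfderivWithin_univ, mfld_simps]
  exact congrArg (chartSymmDeriv x) ((chartAt (EuclideanSpace ℝ (Fin n)) x).right_inv hy).symm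

/-- The metric in the preferred chart at `x`, as a bilinear form depending on the coordinates. -/
def chartMetric (g : Metric n M) (x : M) (y : EuclideanSpace ℝ (Fin n)) :
    EuclideanSpace ℝ (Fin n) →L[ℝ] EuclideanSpace ℝ (Fin n) →L[ℝ] ℝ :=
  (metricForm g ((chartAt (EuclideanSpace ℝ (Fin n)) x).symm y)).bilinearComp
    (chartSymmDeriv x y) (chartSymmDeriv x y)

/-- Smoothness of `g` is a statement about sections of a bundle; pairing it with the sections that
are constant in the trivialisation at `x` gives continuous coefficients. -/
theorem continuousOn_metric_symmL [IsManifold (𝓡 n) 1 M] (g : Metric n M) (x : M)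
    (a b : EuclideanSpace ℝ (Fin n)) :
    ContinuousOn (fun q : M => metricForm g q
      ((trivializationAt (EuclideanSpace ℝ (Fin n)) (TangentSpace (𝓡 n)) x).symmL ℝ q a)
      ((trivializationAt (EuclideanSpace ℝ (Fin n)) (TangentSpace (𝓡 n)) x).symmL ℝ q b))
      (chartAt (EuclideanSpace ℝ (Fin n)) x).source := by
  set e := trivializationAt (EuclideanSpace ℝ (Fin n)) (TangentSpace (𝓡 n) (M := M)) x
  intro q hq
  have hq' : q ∈ e.baseSet := hq
  have hsec : ∀ a : EuclideanSpace ℝ (Fin n), ContMDiffAt (𝓡 n)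
      ((𝓡 n).prod 𝓘(ℝ, EuclideanSpace ℝ (Fin n))) 0
      (fun q : M => Bundle.TotalSpace.mk' (EuclideanSpace ℝ (Fin n))
        (E := fun q : M => TangentSpace (𝓡 n) q) q (e.symmL ℝ q a)) q := by
    intro a
    rw [e.contMDiffAt_section_iff hq']
    refine (contMDiffAt_const (c := a)).congr_of_eventuallyEq ?_
    filter_upwards [e.open_baseSet.mem_nhds hq'] with z hz
    rw [e.symmL_apply hz, e.apply_mk_symm hz]
  have hg : ContMDiffAt (𝓡 n) ((𝓡 n).prod 𝓘(ℝ, EuclideanSpace ℝ (Fin n) →L[ℝ]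
      EuclideanSpace ℝ (Fin n) →L[ℝ] ℝ)) 0 (fun b => Bundle.TotalSpace.mk'
        (EuclideanSpace ℝ (Fin n) →L[ℝ] EuclideanSpace ℝ (Fin n) →L[ℝ] ℝ)
        (E := fun q : M => TangentSpace (𝓡 n) q →L[ℝ] TangentSpace (𝓡 n) q →L[ℝ] ℝ) b (g.inner b)) q :=
    (g.contMDiff q).of_le (by exact_mod_cast bot_le)
  have h3 : ContMDiffAt (𝓡 n) ((𝓡 n).prod 𝓘(ℝ, ℝ)) 0
      (fun m => Bundle.TotalSpace.mk' ℝ (E := Bundle.Trivial M ℝ) m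
        (g.inner m (e.symmL ℝ m a) (e.symmL ℝ m b))) q := by
    apply ContMDiffAt.clm_bundle_apply₂ (F₁ := EuclideanSpace ℝ (Fin n))
      (F₂ := EuclideanSpace ℝ (Fin n))
    · exact hg
    · exact hsec a
    · exact hsec b
  rw [Bundle.contMDiffAt_totalSpace] at h3
  exact h3.2.continuousAt.continuousWithinAt

theorem continuousOn_chartMetric (g : Metric n M) (x : M) :
    ContinuousOn (chartMetric g x) (chartAt (EuclideanSpace ℝ (Fin n)) x).target := by
  have : IsManifold (𝓡 n) 1 M := IsManifold.of_le (n := ∞) (by exact_mod_cast le_top)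
  rw [continuousOn_clm_apply]
  intro a
  rw [continuousOn_clm_apply]
  intro b
  refine ((continuousOn_metric_symmL g x a b).comp
    (chartAt (EuclideanSpace ℝ (Fin n)) x).continuousOn_symm
    (chartAt (EuclideanSpace ℝ (Fin n)) x).mapsTo_symm).congr fun y hy => ?_
  simp only [chartMetric, chartSymmDeriv_eq_symmL hy]
  rfl

theorem gramMatrix_eq_chartMetric (g : Metric n M) (x : M) (y : EuclideanSpace ℝ (Fin n)) :
    gramMatrix g x y = Matrix.of fun i j => chartMetric g x y (EuclideanSpace.single i 1)
      (EuclideanSpace.single j 1) := rfl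

theorem continuousOn_chartDensity (g : Metric n M) (x : M) :
    ContinuousOn (chartDensity g x) (chartAt (EuclideanSpace ℝ (Fin n)) x).target := by
  refine Real.continuous_sqrt.comp_continuousOn ?_
  have h : ContinuousOn (gramMatrix g x) (chartAt (EuclideanSpace ℝ (Fin n)) x).target := by
    refine continuousOn_pi.2 fun i => continuousOn_pi.2 fun j => ?_
    exact ((continuousOn_chartMetric g x).clm_apply continuousOn_const).clm_apply continuousOn_const
  exact (continuous_id.matrix_det).comp_continuousOn h

theorem chartSymmDeriv_injective {x : M} {y : EuclideanSpace ℝ (Fin n)}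
    (hy : y ∈ (chartAt (EuclideanSpace ℝ (Fin n)) x).target) :
    Function.Injective (chartSymmDeriv x y) := by
  have : IsManifold (𝓡 n) 1 M := IsManifold.of_le (n := ∞) (by exact_mod_cast le_top)
  exact (mdifferentiable_chart (I := 𝓡 n) x).symm.mfderiv_injective hy

theorem chartMetric_symm (g : Metric n M) (x : M) (y a b : EuclideanSpace ℝ (Fin n)) :
    chartMetric g x y a b = chartMetric g x y b a :=
  g.symm ((chartAt (EuclideanSpace ℝ (Fin n)) x).symm y) _ _

theorem chartMetric_pos (g : Metric n M) {x : M} {y : EuclideanSpace ℝ (Fin n)}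
    (hy : y ∈ (chartAt (EuclideanSpace ℝ (Fin n)) x).target) {a : EuclideanSpace ℝ (Fin n)}
    (ha : a ≠ 0) : 0 < chartMetric g x y a a := by
  refine g.pos ((chartAt (EuclideanSpace ℝ (Fin n)) x).symm y) (chartSymmDeriv x y a) ?_
  intro h
  exact ha (chartSymmDeriv_injective hy (h.trans (map_zero (chartSymmDeriv x y)).symm))

/-- An inner product on a vector space of dimension `n` is isometric to the Euclidean one. -/
theorem exists_linearEquiv_of_core {V : Type*} [AddCommGroup V] [Module ℝ V] [FiniteDimensional ℝ V]
    (hV : Module.finrank ℝ V = n) (cd : InnerProductSpace.Core ℝ V) :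
    ∃ L : EuclideanSpace ℝ (Fin n) ≃ₗ[ℝ] V, ∀ a b, cd.inner (L a) (L b) = inner ℝ a b := by
  let _ : NormedAddCommGroup V := cd.toNormedAddCommGroup
  let _ : InnerProductSpace ℝ V := InnerProductSpace.ofCore cd.toCore
  subst hV
  exact ⟨(stdOrthonormalBasis ℝ V).repr.symm.toLinearEquiv,
    fun a b => (stdOrthonormalBasis ℝ V).repr.symm.inner_map_map a b⟩

theorem exists_normalising_equiv (g : Metric n M) {x : M} {y : EuclideanSpace ℝ (Fin n)}
    (hy : y ∈ (chartAt (EuclideanSpace ℝ (Fin n)) x).target) :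
    ∃ L : EuclideanSpace ℝ (Fin n) ≃L[ℝ] EuclideanSpace ℝ (Fin n),
      ∀ a b, chartMetric g x y (L a) (L b) = inner ℝ a b := by
  let cd : InnerProductSpace.Core ℝ (EuclideanSpace ℝ (Fin n)) :=
    { inner := fun a b => chartMetric g x y a b
      conj_inner_symm := fun a b => chartMetric_symm g x y b a
      re_inner_nonneg := fun a => by
        rcases eq_or_ne a 0 with rfl | ha
        · simp
        · exact (chartMetric_pos g hy ha).le
      add_left := fun a b c => by simp
      smul_left := fun a b r => by simp
      definite := fun a h => by
        by_contra ha
        exact (chartMetric_pos g hy ha).ne' h }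
  obtain ⟨L, hL⟩ := exists_linearEquiv_of_core (finrank_euclideanSpace_fin (𝕜 := ℝ)) cd
  exact ⟨L.toContinuousLinearEquiv, hL⟩

theorem abs_det_mul_chartDensity (g : Metric n M) {x : M} {y : EuclideanSpace ℝ (Fin n)}
    {L : EuclideanSpace ℝ (Fin n) ≃L[ℝ] EuclideanSpace ℝ (Fin n)}
    (hL : ∀ a b, chartMetric g x y (L a) (L b) = inner ℝ a b) :
    |(L : EuclideanSpace ℝ (Fin n) →L[ℝ] EuclideanSpace ℝ (Fin n)).det| * chartDensity g x y = 1 := by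
  have h := det_bilin_comp (chartMetric g x y)
    (L : EuclideanSpace ℝ (Fin n) →L[ℝ] EuclideanSpace ℝ (Fin n))
  have h1 : (Matrix.of fun i j : Fin n => chartMetric g x y
      ((L : EuclideanSpace ℝ (Fin n) →L[ℝ] EuclideanSpace ℝ (Fin n)) (EuclideanSpace.single i 1))
      ((L : EuclideanSpace ℝ (Fin n) →L[ℝ] EuclideanSpace ℝ (Fin n)) (EuclideanSpace.single j 1))) =
      1 := by
    ext i j
    rw [Matrix.of_apply, ContinuousLinearEquiv.coe_coe, hL, EuclideanSpace.inner_single_left,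
      Matrix.one_apply]
    simp
  rw [h1, Matrix.det_one, ← gramMatrix_eq_chartMetric] at h
  rw [chartDensity, ← Real.sqrt_sq_eq_abs, ← Real.sqrt_mul (sq_nonneg _), ← h, Real.sqrt_one]

theorem eventually_norm_sub_lt_of_continuousAt {X F : Type*} [TopologicalSpace X]
    [SeminormedAddCommGroup F] {f : X → F} {x : X} (h : ContinuousAt f x) {η : ℝ} (hη : 0 < η) :
    ∀ᶠ z in 𝓝 x, ‖f z - f x‖ < η := by
  simpa only [dist_eq_norm] using Metric.continuousAt_iff'.1 h η hη

/-- Near the centre of normalised coordinates the metric is almost Euclidean. -/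
theorem eventually_norm_sq_le_chartMetric (g : Metric n M) {x : M} {y : EuclideanSpace ℝ (Fin n)}
    (hy : y ∈ (chartAt (EuclideanSpace ℝ (Fin n)) x).target)
    {L : EuclideanSpace ℝ (Fin n) ≃L[ℝ] EuclideanSpace ℝ (Fin n)}
    (hL : ∀ a b, chartMetric g x y (L a) (L b) = inner ℝ a b) {l : ℝ} (hl : 1 < l) :
    ∀ᶠ z in 𝓝 y, ∀ b, ‖b‖ ^ 2 ≤ l ^ 2 * chartMetric g x z (L b) (L b) := by
  set Λ := ‖(L : EuclideanSpace ℝ (Fin n) →L[ℝ] EuclideanSpace ℝ (Fin n))‖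
  -- Chosen so that `η Λ² ≤ 1 - l⁻²`, the loss allowed on `‖b‖²`; the `+ 1` keeps the denominator
  -- positive.
  set η := (1 - (l ^ 2)⁻¹) / (Λ ^ 2 + 1)
  have hl2 : 1 < l ^ 2 := by nlinarith
  have hη : 0 < η := div_pos (sub_pos.2 (inv_lt_one_of_one_lt₀ hl2)) (by positivity)
  have hc : ContinuousAt (chartMetric g x) y := (continuousOn_chartMetric g x).continuousAt
    ((chartAt (EuclideanSpace ℝ (Fin n)) x).open_target.mem_nhds hy)
  filter_upwards [eventually_norm_sub_lt_of_continuousAt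
    (F := EuclideanSpace ℝ (Fin n) →L[ℝ] EuclideanSpace ℝ (Fin n) →L[ℝ] ℝ) hc hη] with z hz b
  have h1 : |(chartMetric g x z - chartMetric g x y) (L b) (L b)| ≤ η * (Λ * ‖b‖) * (Λ * ‖b‖) := by
    rw [← Real.norm_eq_abs]
    refine (ContinuousLinearMap.le_opNorm₂ _ _ _).trans ?_
    have h2 : ‖L b‖ ≤ Λ * ‖b‖ :=
      (L : EuclideanSpace ℝ (Fin n) →L[ℝ] EuclideanSpace ℝ (Fin n)).le_opNorm b
    gcongr
  have h3 : chartMetric g x y (L b) (L b) = ‖b‖ ^ 2 := by rw [hL, real_inner_self_eq_norm_sq]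
  have h4 : η * Λ ^ 2 ≤ 1 - (l ^ 2)⁻¹ := by
    have : η * (Λ ^ 2 + 1) = 1 - (l ^ 2)⁻¹ := div_mul_cancel₀ _ (by positivity)
    nlinarith
  have h5 : (chartMetric g x z - chartMetric g x y) (L b) (L b) =
      chartMetric g x z (L b) (L b) - ‖b‖ ^ 2 := by
    rw [← h3]; rfl
  rw [h5] at h1
  have h6 := neg_le_of_abs_le h1
  have h7 : η * Λ ^ 2 * ‖b‖ ^ 2 ≤ (1 - (l ^ 2)⁻¹) * ‖b‖ ^ 2 := by gcongr
  have h8 : (l ^ 2)⁻¹ * ‖b‖ ^ 2 ≤ chartMetric g x z (L b) (L b) := by nlinarith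
  rwa [inv_mul_le_iff₀ (by positivity)] at h8

end ChartMetric

/-! ### Transplanting functions to the manifold -/

section Transplant

variable {n : ℕ}

/-- The affine map `z ↦ y + ε L z`. -/
def scaling (y : EuclideanSpace ℝ (Fin n))
    (L : EuclideanSpace ℝ (Fin n) ≃L[ℝ] EuclideanSpace ℝ (Fin n)) (ε : ℝ)
    (z : EuclideanSpace ℝ (Fin n)) : EuclideanSpace ℝ (Fin n) := y + ε • L z

/-- The inverse of `scaling y L ε`. -/
def unscaling (y : EuclideanSpace ℝ (Fin n))
    (L : EuclideanSpace ℝ (Fin n) ≃L[ℝ] EuclideanSpace ℝ (Fin n)) (ε : ℝ)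
    (z : EuclideanSpace ℝ (Fin n)) : EuclideanSpace ℝ (Fin n) := ε⁻¹ • L.symm (z - y)

variable {y : EuclideanSpace ℝ (Fin n)}
  {L : EuclideanSpace ℝ (Fin n) ≃L[ℝ] EuclideanSpace ℝ (Fin n)} {ε : ℝ}

theorem unscaling_scaling (hε : ε ≠ 0) (z : EuclideanSpace ℝ (Fin n)) :
    unscaling y L ε (scaling y L ε z) = z := by
  simp [scaling, unscaling, smul_smul, hε]

theorem scaling_unscaling (hε : ε ≠ 0) (z : EuclideanSpace ℝ (Fin n)) :
    scaling y L ε (unscaling y L ε z) = z := by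
  simp [scaling, unscaling, smul_smul, hε]

theorem continuous_scaling : Continuous (scaling y L ε) := by
  unfold scaling
  fun_prop

theorem contDiff_unscaling : ContDiff ℝ ∞ (unscaling y L ε) :=
  (L.symm.contDiff.comp (contDiff_id.sub contDiff_const)).const_smul _

theorem hasFDerivAt_scaling (z : EuclideanSpace ℝ (Fin n)) :
    HasFDerivAt (scaling y L ε)
      (ε • (L : EuclideanSpace ℝ (Fin n) →L[ℝ] EuclideanSpace ℝ (Fin n))) z :=
  (L.hasFDerivAt.const_smul ε).const_add y

theorem hasFDerivAt_unscaling (z : EuclideanSpace ℝ (Fin n)) :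
    HasFDerivAt (unscaling y L ε)
      (ε⁻¹ • (L.symm : EuclideanSpace ℝ (Fin n) →L[ℝ] EuclideanSpace ℝ (Fin n))) z := by
  have h := ((L.symm : EuclideanSpace ℝ (Fin n) →L[ℝ] EuclideanSpace ℝ (Fin n)).hasFDerivAt
    (x := z - y)).comp z ((hasFDerivAt_id z).sub_const y)
  rw [ContinuousLinearMap.comp_id] at h
  exact HasFDerivAt.const_smul h ε⁻¹

theorem det_smul_equiv : (ε • (L : EuclideanSpace ℝ (Fin n) →L[ℝ] EuclideanSpace ℝ (Fin n))).det =
    ε ^ n * (L : EuclideanSpace ℝ (Fin n) →L[ℝ] EuclideanSpace ℝ (Fin n)).det := by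
  simp [ContinuousLinearMap.det, LinearMap.det_smul]

variable {M : Type*} [TopologicalSpace M] [ChartedSpace (EuclideanSpace ℝ (Fin n)) M]

/-- The function `Φ` on `ℝⁿ`, rescaled and transplanted to the domain of the chart at `x`. -/
def transplant (x : M) (y : EuclideanSpace ℝ (Fin n))
    (L : EuclideanSpace ℝ (Fin n) ≃L[ℝ] EuclideanSpace ℝ (Fin n)) (ε : ℝ)
    (Φ : EuclideanSpace ℝ (Fin n) → ℝ) : M → ℝ :=
  (chartAt (EuclideanSpace ℝ (Fin n)) x).source.indicator
    fun q => Φ (unscaling y L ε (chartAt (EuclideanSpace ℝ (Fin n)) x q))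

theorem transplant_comp {x : M} {Φ : EuclideanSpace ℝ (Fin n) → ℝ} {H : ℝ → ℝ} (hH : H 0 = 0)
    (q : M) : H (transplant x y L ε Φ q) = transplant x y L ε (fun z => H (Φ z)) q := by
  by_cases hq : q ∈ (chartAt (EuclideanSpace ℝ (Fin n)) x).source
  · simp [transplant, hq]
  · simp [transplant, hq, hH]

variable [IsManifold (𝓡 n) ∞ M]

/-- The normalised volume density in the rescaled chart. -/
def scaledDensity (g : Metric n M) (x : M) (y : EuclideanSpace ℝ (Fin n))
    (L : EuclideanSpace ℝ (Fin n) ≃L[ℝ] EuclideanSpace ℝ (Fin n)) (ε : ℝ)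
    (z : EuclideanSpace ℝ (Fin n)) : ℝ :=
  |(L : EuclideanSpace ℝ (Fin n) →L[ℝ] EuclideanSpace ℝ (Fin n)).det| *
    chartDensity g x (scaling y L ε z)

theorem scaledDensity_nonneg (g : Metric n M) (x : M) (z : EuclideanSpace ℝ (Fin n)) :
    0 ≤ scaledDensity g x y L ε z :=
  mul_nonneg (abs_nonneg _) (Real.sqrt_nonneg _)

theorem integrable_scaledDensity_mul (g : Metric n M) {x : M} {R : ℝ}
    (hK : MapsTo (scaling y L ε) (Metric.closedBall 0 R)
      (chartAt (EuclideanSpace ℝ (Fin n)) x).target)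
    {Φ : EuclideanSpace ℝ (Fin n) → ℝ} (hΦ : Continuous Φ)
    (hΦR : Function.support Φ ⊆ Metric.closedBall 0 R) :
    Integrable fun z => scaledDensity g x y L ε z * Φ z := by
  have h1 : ContinuousOn (fun z => scaledDensity g x y L ε z * Φ z) (Metric.closedBall 0 R) :=
    (continuousOn_const.mul ((continuousOn_chartDensity g x).comp
      continuous_scaling.continuousOn hK)).mul hΦ.continuousOn
  refine (integrableOn_iff_integrable_of_support_subset ?_).1
    (h1.integrableOn_compact (isCompact_closedBall _ _))
  intro z hz
  exact hΦR (right_ne_zero_of_mul hz)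

variable [MeasurableSpace M] [BorelSpace M]

/-- Two changes of variables, the chart and then `scaling`; the latter contributes the Jacobian `ε^n
|det L|`. -/
theorem integral_transplant (g : Metric n M) {x : M} {R : ℝ} (hε : 0 < ε)
    (hK : MapsTo (scaling y L ε) (Metric.closedBall 0 R)
      (chartAt (EuclideanSpace ℝ (Fin n)) x).target)
    {Φ : EuclideanSpace ℝ (Fin n) → ℝ} (hΦ : Continuous Φ)
    (hΦR : Function.support Φ ⊆ Metric.closedBall 0 R) :
    Integrable (transplant x y L ε Φ) (vol g) ∧
      ∫ q, transplant x y L ε Φ q ∂vol g = ε ^ n * ∫ z, scaledDensity g x y L ε z * Φ z := by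
  set c := chartAt (EuclideanSpace ℝ (Fin n)) x
  set h : M → ℝ := fun q => Φ (unscaling y L ε (c q))
  have hunc : Continuous (unscaling y L ε) := contDiff_unscaling.continuous
  have hsrc : MeasurableSet c.source := c.open_source.measurableSet
  have htgt : MeasurableSet c.target := c.open_target.measurableSet
  have hhm : AEStronglyMeasurable h (chartVolume g x) := by
    rw [← vol_restrict_source]
    exact ((hΦ.comp hunc).comp_continuousOn c.continuousOn).aestronglyMeasurable hsrc
  have hd : AEMeasurable (fun z => (chartDensity g x z).toNNReal) (volume.restrict c.target) :=
    ((continuousOn_chartDensity g x).aemeasurable htgt).real_toNNReal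
  have hsm : AEMeasurable c.symm ((volume.restrict c.target).withDensity
      fun z => ENNReal.ofReal (Real.sqrt (gramMatrix g x z).det)) :=
    (aemeasurable_chart_symm x).mono_ac (withDensity_absolutelyContinuous _ _)
  have hcong : ∀ z ∈ c.target, (chartDensity g x z).toNNReal • h (c.symm z) =
      chartDensity g x z * Φ (unscaling y L ε z) := by
    intro z hz
    simp only [h, NNReal.smul_def, smul_eq_mul, c.right_inv hz,
      Real.coe_toNNReal _ (show 0 ≤ chartDensity g x z from Real.sqrt_nonneg _)]
  -- Off the chart target the density has no meaning, but the rescaled support of `Φ` lies inside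
  -- the target.
  have hoff : ∀ z, z ∉ c.target → chartDensity g x z * Φ (unscaling y L ε z) = 0 := by
    intro z hz
    by_contra hne
    have h1 := hΦR (show unscaling y L ε z ∈ Function.support Φ from right_ne_zero_of_mul hne)
    have h2 := hK h1
    rw [scaling_unscaling hε.ne'] at h2
    exact hz h2
  have himg : scaling y L ε '' univ = univ :=
    image_univ_of_surjective fun z => ⟨unscaling y L ε z, scaling_unscaling hε.ne' z⟩
  have hinj : InjOn (scaling y L ε) univ := fun a _ b _ hab => by
    rw [← unscaling_scaling (y := y) (L := L) hε.ne' a, hab, unscaling_scaling hε.ne']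
  have hjac : ∀ z, |(ε • (L : EuclideanSpace ℝ (Fin n) →L[ℝ] EuclideanSpace ℝ (Fin n))).det| •
      (chartDensity g x (scaling y L ε z) * Φ (unscaling y L ε (scaling y L ε z))) =
        ε ^ n * (scaledDensity g x y L ε z * Φ z) := by
    intro z
    rw [det_smul_equiv, abs_mul, abs_of_pos (pow_pos hε n), unscaling_scaling hε.ne', smul_eq_mul,
      scaledDensity]
    ring
  have hI : Integrable fun z => chartDensity g x z * Φ (unscaling y L ε z) := by
    rw [← integrableOn_univ, ← himg, integrableOn_image_iff_integrableOn_abs_det_fderiv_smul volume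
      MeasurableSet.univ (fun z _ => (hasFDerivAt_scaling z).hasFDerivWithinAt) hinj,
      integrableOn_univ]
    simp only [hjac]
    exact (integrable_scaledDensity_mul g hK hΦ hΦR).const_mul _
  constructor
  · rw [transplant, integrable_indicator_iff hsrc, IntegrableOn, vol_restrict_source]
    refine (integrable_map_measure hhm hsm).2 ?_
    refine (integrable_withDensity_iff_integrable_smul₀ hd).2 ?_
    exact hI.integrableOn.congr_fun (fun z hz => (hcong z hz).symm) htgt
  · rw [transplant, integral_indicator hsrc, vol_restrict_source]
    have e1 := integral_map hsm hhm
    have e2 := integral_withDensity_eq_integral_smul₀ hd (h ∘ c.symm)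
    calc ∫ q, h q ∂chartVolume g x = ∫ z in c.target, chartDensity g x z * Φ (unscaling y L ε z) :=
          e1.trans (e2.trans (setIntegral_congr_fun htgt hcong))
      _ = ∫ z, chartDensity g x z * Φ (unscaling y L ε z) :=
          setIntegral_eq_integral_of_forall_compl_eq_zero hoff
      _ = _ := by
          rw [← setIntegral_univ, ← himg, integral_image_eq_integral_abs_det_fderiv_smul volume
            MeasurableSet.univ (fun z _ => (hasFDerivAt_scaling z).hasFDerivWithinAt) hinj,
            setIntegral_univ]
          simp only [hjac]
          exact integral_const_mul _ _

end Transplant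

/-! ### Smoothness and gradient of transplanted functions. -/

section Concentration

variable {n : ℕ} {y : EuclideanSpace ℝ (Fin n)}
  {L : EuclideanSpace ℝ (Fin n) ≃L[ℝ] EuclideanSpace ℝ (Fin n)} {ε : ℝ}
  {M : Type*} [TopologicalSpace M] [ChartedSpace (EuclideanSpace ℝ (Fin n)) M]

/-- The image of the ball in `M` is compact, hence closed as `M` is Hausdorff; off it the
transplanted function vanishes on a neighbourhood. Extension by zero is therefore smooth. -/
theorem eventually_mem_source_or_transplant_eq_zero [T2Space M] {x : M} {R : ℝ} (hε : ε ≠ 0)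
    (hK : MapsTo (scaling y L ε) (Metric.closedBall 0 R)
      (chartAt (EuclideanSpace ℝ (Fin n)) x).target)
    {Φ : EuclideanSpace ℝ (Fin n) → ℝ} (hΦR : Function.support Φ ⊆ Metric.closedBall 0 R) (q : M) :
    (q ∈ (chartAt (EuclideanSpace ℝ (Fin n)) x).source ∧
      ∃ z ∈ Metric.closedBall 0 R, chartAt (EuclideanSpace ℝ (Fin n)) x q = scaling y L ε z) ∨
    transplant x y L ε Φ =ᶠ[𝓝 q] fun _ => 0 := by
  set c := chartAt (EuclideanSpace ℝ (Fin n)) x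
  set K := c.symm '' (scaling y L ε '' Metric.closedBall 0 R)
  have hKc : IsClosed K := by
    refine IsCompact.isClosed (IsCompact.image_of_continuousOn
      ((isCompact_closedBall _ _).image continuous_scaling) (c.continuousOn_symm.mono ?_))
    rintro _ ⟨z, hz, rfl⟩
    exact hK hz
  by_cases hq : q ∈ K
  · left
    obtain ⟨_, ⟨z, hz, rfl⟩, rfl⟩ := hq
    exact ⟨c.map_target (hK hz), z, hz, c.right_inv (hK hz)⟩
  · right
    filter_upwards [hKc.isOpen_compl.mem_nhds hq] with q' hq'
    by_cases hs : q' ∈ c.source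
    · rw [transplant, indicator_of_mem hs]
      by_contra hne
      refine hq' ⟨c q', ⟨_, hΦR hne, scaling_unscaling hε _⟩, c.left_inv hs⟩
    · rw [transplant, indicator_of_notMem hs]

theorem transplant_eventuallyEq {x : M} {Φ : EuclideanSpace ℝ (Fin n) → ℝ} {q : M}
    (hq : q ∈ (chartAt (EuclideanSpace ℝ (Fin n)) x).source) :
    transplant x y L ε Φ =ᶠ[𝓝 q]
      (Φ ∘ unscaling y L ε) ∘ (chartAt (EuclideanSpace ℝ (Fin n)) x) := by
  filter_upwards [(chartAt (EuclideanSpace ℝ (Fin n)) x).open_source.mem_nhds hq] with q' hq'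
  exact indicator_of_mem hq' _

variable [IsManifold (𝓡 n) ∞ M]

theorem contMDiff_transplant [T2Space M] {x : M} {R : ℝ} (hε : ε ≠ 0)
    (hK : MapsTo (scaling y L ε) (Metric.closedBall 0 R)
      (chartAt (EuclideanSpace ℝ (Fin n)) x).target)
    {Φ : EuclideanSpace ℝ (Fin n) → ℝ} (hΦ : ContDiff ℝ ∞ Φ)
    (hΦR : Function.support Φ ⊆ Metric.closedBall 0 R) :
    ContMDiff (𝓡 n) 𝓘(ℝ, ℝ) ∞ (transplant x y L ε Φ : M → ℝ) := by
  intro q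
  rcases eventually_mem_source_or_transplant_eq_zero hε hK hΦR q with ⟨hq, -⟩ | h
  · refine ContMDiffAt.congr_of_eventuallyEq ?_ (transplant_eventuallyEq hq)
    exact (hΦ.comp contDiff_unscaling).contMDiff.contMDiffAt.comp q
      (contMDiffOn_chart.contMDiffAt
        ((chartAt (EuclideanSpace ℝ (Fin n)) x).open_source.mem_nhds hq))
  · exact contMDiffAt_const.congr_of_eventuallyEq h

theorem inner_gradient_self (g : Metric n M) (u : M → ℝ) (q : M) :
    g.inner q (gradient g u q) (gradient g u q) = gradNorm g u q ^ 2 := by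
  refine (Real.sq_sqrt ?_).symm
  by_cases h : gradient g u q = 0
  · rw [h]
    simp
  · exact (g.pos q _ h).le

theorem gradNorm_nonneg (g : Metric n M) (u : M → ℝ) (q : M) : 0 ≤ gradNorm g u q :=
  Real.sqrt_nonneg _

theorem gradNorm_eq_zero_of_eventuallyEq (g : Metric n M) {u : M → ℝ} {q : M}
    (h : u =ᶠ[𝓝 q] fun _ => 0) : gradNorm g u q = 0 := by
  have h1 : mfderiv (𝓡 n) 𝓘(ℝ, ℝ) u q = 0 := by
    rw [h.mfderiv_eq]
    exact mfderiv_const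
  have h2 := inner_gradient g u q (gradient g u q)
  rw [h1, inner_gradient_self] at h2
  exact (pow_eq_zero_iff two_ne_zero).1 h2

theorem chartMetric_mfderiv (g : Metric n M) {x q : M}
    (hq : q ∈ (chartAt (EuclideanSpace ℝ (Fin n)) x).source) (w : TangentSpace (𝓡 n) q) :
    chartMetric g x (chartAt (EuclideanSpace ℝ (Fin n)) x q)
      (mfderiv (𝓡 n) (𝓡 n) (chartAt (EuclideanSpace ℝ (Fin n)) x) q w)
      (mfderiv (𝓡 n) (𝓡 n) (chartAt (EuclideanSpace ℝ (Fin n)) x) q w) = g.inner q w w := by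
  have : IsManifold (𝓡 n) 1 M := IsManifold.of_le (n := ∞) (by exact_mod_cast le_top)
  have h : chartSymmDeriv x (chartAt (EuclideanSpace ℝ (Fin n)) x q)
      (mfderiv (𝓡 n) (𝓡 n) (chartAt (EuclideanSpace ℝ (Fin n)) x) q w) = w :=
    congrArg (fun D : EuclideanSpace ℝ (Fin n) →L[ℝ] EuclideanSpace ℝ (Fin n) => D w)
      ((mdifferentiable_chart (I := 𝓡 n) x).symm_comp_deriv hq)
  change metricForm g ((chartAt (EuclideanSpace ℝ (Fin n)) x).symm
    (chartAt (EuclideanSpace ℝ (Fin n)) x q)) (chartSymmDeriv x _ _) (chartSymmDeriv x _ _) = _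
  rw [h, (chartAt (EuclideanSpace ℝ (Fin n)) x).left_inv hq]
  rfl

/-- Apply `du` to the gradient itself: `N² = du(∇u) ≤ ‖dΦ‖ ε⁻¹ ‖L⁻¹ a‖`, where `a` is the gradient
in the chart, and the metric comparison gives `‖L⁻¹ a‖ ≤ l N`. Dividing by `N` finishes. -/
theorem gradNorm_transplant_le [T2Space M] (g : Metric n M) {x : M} {R l : ℝ} (hε : 0 < ε)
    (hl : 0 < l)
    (hK : MapsTo (scaling y L ε) (Metric.closedBall 0 R)
      (chartAt (EuclideanSpace ℝ (Fin n)) x).target)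
    (hQ : ∀ z ∈ Metric.closedBall 0 R, ∀ b,
      ‖b‖ ^ 2 ≤ l ^ 2 * chartMetric g x (scaling y L ε z) (L b) (L b))
    {Φ : EuclideanSpace ℝ (Fin n) → ℝ} (hΦ : ContDiff ℝ ∞ Φ)
    (hΦR : Function.support Φ ⊆ Metric.closedBall 0 R) (q : M) :
    gradNorm g (transplant x y L ε Φ) q ≤
      transplant x y L ε (fun z => l * ε⁻¹ * ‖fderiv ℝ Φ z‖) q := by
  rcases eventually_mem_source_or_transplant_eq_zero hε.ne' hK hΦR q with ⟨hq, z, hz, hcz⟩ | h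
  · set c := chartAt (EuclideanSpace ℝ (Fin n)) x
    set u : M → ℝ := transplant x y L ε Φ
    have : IsManifold (𝓡 n) 1 M := IsManifold.of_le (n := ∞) (by exact_mod_cast le_top)
    set N := gradNorm g u q
    have hN : 0 ≤ N := gradNorm_nonneg g u q
    set a : EuclideanSpace ℝ (Fin n) := mfderiv (𝓡 n) (𝓡 n) c q (gradient g u q)
    have h1 : chartMetric g x (c q) a a = N ^ 2 :=
      (chartMetric_mfderiv g hq _).trans (inner_gradient_self g u q)
    have h2 : N ^ 2 = fderiv ℝ Φ (unscaling y L ε (c q)) (ε⁻¹ • L.symm a) := by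
      have hd : Differentiable ℝ Φ := hΦ.differentiable (by simp)
      have hF := ((hd (unscaling y L ε (c q))).hasFDerivAt).comp (c q)
        (hasFDerivAt_unscaling (y := y) (L := L) (ε := ε) (c q))
      have e1 : mfderiv (𝓡 n) 𝓘(ℝ, ℝ) u q =
          (mfderiv (𝓡 n) 𝓘(ℝ, ℝ) (Φ ∘ unscaling y L ε) (c q)).comp (mfderiv (𝓡 n) (𝓡 n) c q) := by
        rw [(transplant_eventuallyEq hq).mfderiv_eq]
        exact mfderiv_comp q hF.differentiableAt.mdifferentiableAt
          (mdifferentiableAt_atlas (chart_mem_atlas _ x) hq)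
      refine (inner_gradient_self g u q).symm.trans ((inner_gradient g u q _).trans ?_)
      rw [e1, mfderiv_eq_fderiv, hF.fderiv]
      rfl
    have h3 : ‖L.symm a‖ ^ 2 ≤ l ^ 2 * N ^ 2 := by
      have := hQ z hz (L.symm a)
      rwa [← hcz, L.apply_symm_apply, h1] at this
    have h4 : ‖L.symm a‖ ≤ l * N := by
      rw [← mul_pow] at h3
      exact le_of_sq_le_sq h3 (by positivity)
    have h5 : N ^ 2 ≤ ‖fderiv ℝ Φ (unscaling y L ε (c q))‖ * (ε⁻¹ * (l * N)) := by
      rw [h2]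
      refine (Real.le_norm_self _).trans ((ContinuousLinearMap.le_opNorm _ _).trans ?_)
      rw [norm_smul, Real.norm_of_nonneg (by positivity)]
      gcongr
    rw [transplant, indicator_of_mem hq]
    rcases hN.eq_or_lt with h0 | h0
    · rw [← h0]
      positivity
    · refine le_of_mul_le_mul_right ?_ h0
      calc N * N = N ^ 2 := (sq N).symm
        _ ≤ _ := h5
        _ = _ := by ring
  · rw [gradNorm_eq_zero_of_eventuallyEq g h]
    exact indicator_nonneg (fun q _ => by positivity) q

variable [MeasurableSpace M] [BorelSpace M]

theorem memSobolev_of_contMDiff (g : Metric n M) {p : ℝ} (hp : 0 < p) {u : M → ℝ}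
    (hu : ContMDiff (𝓡 n) 𝓘(ℝ, ℝ) ∞ u) (hi : Integrable (fun q => |u q| ^ p) (vol g)) :
    MemSobolev g p u (∫ q, gradNorm g u q ^ p ∂vol g) := by
  refine ⟨?_, fun _ => u, fun _ => hu, ?_, fun ε hε => ⟨0, fun j _ k _ => ?_⟩, tendsto_const_nhds⟩
  · have := (integrable_norm_rpow_iff (p := ENNReal.ofReal p) (μ := vol g)
      hu.continuous.aestronglyMeasurable (by simpa using hp) ENNReal.ofReal_ne_top).1
    refine this ?_
    rw [ENNReal.toReal_ofReal hp.le]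
    exact hi
  · simp
  · have : ∀ q, gradNorm g (u - u) q = 0 := fun q =>
      gradNorm_eq_zero_of_eventuallyEq g (Eventually.of_forall fun q => sub_self (u q))
    simp only [this, Real.zero_rpow hp.ne', integral_zero]
    exact hε

/-- For `t ≤ 0` the bound is `⊥`, which no real number satisfies. -/
theorem exp_le_of_coe_le_logBound {p X t : ℝ} (hn : 0 < (n : ℝ)) (hp : 0 < p)
    (h : (X : EReal) ≤ logBound n p t) : Real.exp (p / n * X) ≤ t := by
  rcases le_or_gt t 0 with ht | ht
  · rw [logBound, ENNReal.ofReal_of_nonpos ht, ENNReal.log_zero,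
      EReal.coe_mul_bot_of_pos (div_pos hn hp)] at h
    exact absurd (le_bot_iff.1 h) (EReal.coe_ne_bot X)
  · rw [logBound, ENNReal.log_ofReal_of_pos ht, ← EReal.coe_mul, EReal.coe_le_coe_iff] at h
    rw [← Real.le_log_iff_exp_le ht]
    calc p / n * X ≤ p / n * (n / p * Real.log t) := by gcongr
      _ = Real.log t := by field_simp

end Concentration

/-! ### Testing the Riemannian inequality and letting the scale tend to zero. -/

section Limit

variable {n : ℕ} {y : EuclideanSpace ℝ (Fin n)}
  {L : EuclideanSpace ℝ (Fin n) ≃L[ℝ] EuclideanSpace ℝ (Fin n)} {ε : ℝ}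
  {M : Type*} [TopologicalSpace M] [ChartedSpace (EuclideanSpace ℝ (Fin n)) M]
  [IsManifold (𝓡 n) ∞ M]

theorem entDensity_const_mul {X : Type*} {p m : ℝ} (hp : 0 < p) (hm : 0 < m) {s : ℝ} (hs : 0 ≤ s)
    (hsm : s ^ p = m⁻¹) (u : X → ℝ) (z : X) :
    entDensity p (fun z => s * u z) z = m⁻¹ * entDensity p u z - m⁻¹ * Real.log m * |u z| ^ p := by
  have h : |s * u z| ^ p = m⁻¹ * |u z| ^ p := by
    rw [abs_mul, abs_of_nonneg hs, Real.mul_rpow hs (abs_nonneg _), hsm]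
  simp only [entDensity, h]
  rcases eq_or_ne (u z) 0 with h0 | h0
  · simp [h0, hp.ne']
  · have : 0 < |u z| ^ p := Real.rpow_pos_of_pos (abs_pos.2 h0) p
    rw [Real.log_mul (inv_ne_zero hm.ne') this.ne', Real.log_inv]
    ring

variable [MeasurableSpace M] [BorelSpace M]

/-- The Riemannian entropy inequality, tested against a rescaled and transplanted function. -/
theorem RiemannianEntropyInequality.transplant [T2Space M] {g : Metric n M} {p A B : ℝ}
    (hAB : RiemannianEntropyInequality g p A B) (hn : 0 < (n : ℝ)) (hp : 0 < p)
    {x : M} {R l : ℝ} (hε : 0 < ε) (hl : 0 < l)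
    (hK : MapsTo (scaling y L ε) (Metric.closedBall 0 R)
      (chartAt (EuclideanSpace ℝ (Fin n)) x).target)
    (hQ : ∀ z ∈ Metric.closedBall 0 R, ∀ b,
      ‖b‖ ^ 2 ≤ l ^ 2 * chartMetric g x (scaling y L ε z) (L b) (L b))
    {φ : EuclideanSpace ℝ (Fin n) → ℝ} (hφ : ContDiff ℝ ∞ φ)
    (hφR : tsupport φ ⊆ Metric.closedBall 0 R)
    (hm : 0 < ∫ z, scaledDensity g x y L ε z * |φ z| ^ p) :
    Real.exp (p / n * ((∫ z, scaledDensity g x y L ε z * entDensity p φ z) /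
        (∫ z, scaledDensity g x y L ε z * |φ z| ^ p) -
        Real.log (∫ z, scaledDensity g x y L ε z * |φ z| ^ p))) ≤
      max A 0 * (l ^ p * (∫ z, scaledDensity g x y L ε z * ‖fderiv ℝ φ z‖ ^ p) /
        ∫ z, scaledDensity g x y L ε z * |φ z| ^ p) + max B 0 * ε ^ p := by
  set w := scaledDensity g x y L ε
  set m := ∫ z, w z * |φ z| ^ p
  set E := ∫ z, w z * entDensity p φ z
  set Γ := ∫ z, w z * ‖fderiv ℝ φ z‖ ^ p
  have hεn : 0 < ε ^ n := pow_pos hε n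
  set m' := ε ^ n * m
  have hm' : 0 < m' := mul_pos hεn hm
  -- The factor that normalises the transplanted function, whose mass is `m' = ε^n m`.
  set s := m'⁻¹ ^ p⁻¹
  have hs : 0 ≤ s := by positivity
  have hsp : s ^ p = m'⁻¹ := Real.rpow_inv_rpow (by positivity) hp.ne'
  have hφs : Function.support φ ⊆ Metric.closedBall 0 R := (subset_tsupport φ).trans hφR
  set ψ : EuclideanSpace ℝ (Fin n) → ℝ := fun z => s * φ z
  have hψ : ContDiff ℝ ∞ ψ := contDiff_const.mul hφ
  have hψR : Function.support ψ ⊆ Metric.closedBall 0 R := fun z hz =>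
    hφs (right_ne_zero_of_mul hz)
  have hφp : Continuous fun z => |φ z| ^ p := hφ.continuous.abs.rpow_const fun _ => Or.inr hp.le
  have hφe : Continuous (entDensity p φ) := (continuous_entDensity_real hp).comp hφ.continuous
  have hφg : Continuous fun z => ‖fderiv ℝ φ z‖ ^ p :=
    (hφ.continuous_fderiv (by simp)).norm.rpow_const fun _ => Or.inr hp.le
  have hsupp : ∀ z, z ∉ Metric.closedBall (0 : EuclideanSpace ℝ (Fin n)) R → φ z = 0 := fun z hz => by
    by_contra hne
    exact hz (hφs hne)
  have hsuppd : ∀ z, z ∉ Metric.closedBall (0 : EuclideanSpace ℝ (Fin n)) R → fderiv ℝ φ z = 0 :=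
    fun z hz => by
      by_contra hne
      exact hz (hφR (support_fderiv_subset ℝ hne))
  have sp : Function.support (fun z => |φ z| ^ p) ⊆ Metric.closedBall 0 R := fun z hz => by
    by_contra hne
    simp [hsupp z hne, hp.ne'] at hz
  have se : Function.support (entDensity p φ) ⊆ Metric.closedBall 0 R := fun z hz => by
    by_contra hne
    simp [entDensity, hsupp z hne, hp.ne'] at hz
  have sg : Function.support (fun z => ‖fderiv ℝ φ z‖ ^ p) ⊆ Metric.closedBall 0 R := fun z hz => by
    by_contra hne
    simp [hsuppd z hne, hp.ne'] at hz
  have hwE := integrable_scaledDensity_mul g hK hφe se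
  have hwm := integrable_scaledDensity_mul g hK hφp sp
  set u : M → ℝ := EntropyConst.transplant x y L ε ψ
  have hu : ContMDiff (𝓡 n) 𝓘(ℝ, ℝ) ∞ u := contMDiff_transplant hε.ne' hK hψ hψR
  -- the mass
  have hup : (fun q => |u q| ^ p) = EntropyConst.transplant x y L ε fun z => m'⁻¹ * |φ z| ^ p := by
    ext q
    rw [transplant_comp (H := fun t => |t| ^ p) (by simp [hp.ne'])]
    congr 1
    ext z
    rw [abs_mul, abs_of_nonneg hs, Real.mul_rpow hs (abs_nonneg _), hsp]
  have T1 := integral_transplant g hε hK (Φ := fun z => m'⁻¹ * |φ z| ^ p) (continuous_const.mul hφp)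
    fun z hz => sp (right_ne_zero_of_mul hz)
  have hmass : ∫ q, |u q| ^ p ∂vol g = 1 := by
    rw [hup, T1.2]
    have : ∀ z, scaledDensity g x y L ε z * (m'⁻¹ * |φ z| ^ p) =
        m'⁻¹ * (scaledDensity g x y L ε z * |φ z| ^ p) := fun z => by ring
    simp only [this]
    rw [integral_const_mul, mul_left_comm]
    exact inv_mul_cancel₀ hm'.ne'
  -- the entropy
  have hue : entDensity p u = EntropyConst.transplant x y L ε (entDensity p ψ) :=
    funext fun q => transplant_comp (H := fun t => |t| ^ p * Real.log (|t| ^ p))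
      (by simp [hp.ne']) q
  have T2 := integral_transplant g hε hK (Φ := entDensity p ψ)
    ((continuous_entDensity_real hp).comp hψ.continuous) fun z hz => by
      by_contra hne
      simp [entDensity, ψ, hsupp z hne, hp.ne'] at hz
  have hent : ∫ q, entDensity p u q ∂vol g = E / m - Real.log m - n * Real.log ε := by
    rw [hue, T2.2]
    have : ∀ z, scaledDensity g x y L ε z * entDensity p ψ z =
        m'⁻¹ * (scaledDensity g x y L ε z * entDensity p φ z) -
          m'⁻¹ * Real.log m' * (scaledDensity g x y L ε z * |φ z| ^ p) := fun z => by
      rw [entDensity_const_mul hp hm' hs hsp]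
      ring
    simp only [this]
    rw [integral_sub (hwE.const_mul _) (hwm.const_mul _), integral_const_mul, integral_const_mul]
    have h1 : Real.log m' = n * Real.log ε + Real.log m := by
      rw [Real.log_mul hεn.ne' hm.ne', Real.log_pow]
    change ε ^ n * (m'⁻¹ * E - m'⁻¹ * Real.log m' * m) = _
    rw [h1]
    simp only [m']
    field_simp
    ring
  -- the Dirichlet integral
  have hD : ∫ q, gradNorm g u q ^ p ∂vol g ≤ l ^ p * (ε ^ p)⁻¹ * (Γ / m) := by
    have hdψ : ∀ z, ‖fderiv ℝ ψ z‖ = s * ‖fderiv ℝ φ z‖ := fun z => by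
      rw [fderiv_const_mul (hφ.differentiable (by simp) z), norm_smul, Real.norm_of_nonneg hs]
    have T3 := integral_transplant g hε hK
      (Φ := fun z => l ^ p * (ε ^ p)⁻¹ * m'⁻¹ * ‖fderiv ℝ φ z‖ ^ p)
      (continuous_const.mul hφg) fun z hz => sg (right_ne_zero_of_mul hz)
    have hle : ∀ q, gradNorm g u q ^ p ≤ EntropyConst.transplant x y L ε
        (fun z => l ^ p * (ε ^ p)⁻¹ * m'⁻¹ * ‖fderiv ℝ φ z‖ ^ p) q := by
      intro q
      refine (Real.rpow_le_rpow (gradNorm_nonneg g u q)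
        (gradNorm_transplant_le g hε hl hK hQ hψ hψR q) hp.le).trans (le_of_eq ?_)
      rw [transplant_comp (H := fun t => t ^ p) (Real.zero_rpow hp.ne')]
      congr 1
      ext z
      rw [hdψ, Real.mul_rpow (by positivity) (by positivity), Real.mul_rpow hl.le (by positivity),
        Real.inv_rpow hε.le, Real.mul_rpow hs (norm_nonneg _), hsp]
      ring
    refine (integral_mono_of_nonneg (Eventually.of_forall fun q =>
      Real.rpow_nonneg (gradNorm_nonneg g u q) p) T3.1 (Eventually.of_forall hle)).trans
      (le_of_eq ?_)
    rw [T3.2]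
    simp only [mul_left_comm _ (l ^ p * (ε ^ p)⁻¹ * m'⁻¹)]
    rw [integral_const_mul]
    change ε ^ n * (l ^ p * (ε ^ p)⁻¹ * m'⁻¹ * Γ) = _
    simp only [m']
    field_simp
  have hD0 : 0 ≤ ∫ q, gradNorm g u q ^ p ∂vol g :=
    integral_nonneg fun q => Real.rpow_nonneg (gradNorm_nonneg g u q) p
  have hineq := hAB u _ (memSobolev_of_contMDiff g hp hu (by rw [hup]; exact T1.1)) hmass
  rw [entropy_eq_of_integrable (by rw [hue]; exact T2.1), hent] at hineq
  have hexp := exp_le_of_coe_le_logBound hn hp hineq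
  have hεp : 0 < ε ^ p := Real.rpow_pos_of_pos hε p
  -- The entropy shift becomes `ε^(-p)`, matching the Dirichlet integral. Multiplying by `ε^p` frees
  -- both and leaves `B ε^p`.
  have e1 : Real.exp (p / n * (E / m - Real.log m - n * Real.log ε)) =
      Real.exp (p / n * (E / m - Real.log m)) * (ε ^ p)⁻¹ := by
    rw [← Real.rpow_neg hε.le, Real.rpow_def_of_pos hε, ← Real.exp_add]
    congr 1
    field_simp
    ring
  rw [e1, ← div_eq_mul_inv, div_le_iff₀ hεp] at hexp
  refine hexp.trans ?_
  rw [add_mul]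
  refine add_le_add ?_ (mul_le_mul_of_nonneg_right (le_max_left _ _) hεp.le)
  -- The Dirichlet integral is only bounded above and the sign of `A` is not yet known, hence `max A
  -- 0`.
  calc A * (∫ q, gradNorm g u q ^ p ∂vol g) * ε ^ p
      ≤ max A 0 * (l ^ p * (ε ^ p)⁻¹ * (Γ / m)) * ε ^ p := by
        refine mul_le_mul_of_nonneg_right ?_ hεp.le
        exact (mul_le_mul_of_nonneg_right (le_max_left _ _) hD0).trans
          (mul_le_mul_of_nonneg_left hD (le_max_right _ _))
    _ = _ := by field_simp

-- Uniformity over the ball comes from its compactness, since `scaling y L 0` is constantly `y`.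
omit [IsManifold (𝓡 n) ∞ M] [MeasurableSpace M] [BorelSpace M] [TopologicalSpace M]
  [ChartedSpace (EuclideanSpace ℝ (Fin n)) M] in
theorem eventually_scaling_mem {U : Set (EuclideanSpace ℝ (Fin n))} (hU : U ∈ 𝓝 y) (R : ℝ) :
    ∀ᶠ ε in 𝓝[>] (0 : ℝ), ∀ z ∈ Metric.closedBall (0 : EuclideanSpace ℝ (Fin n)) R,
      scaling y L ε z ∈ U := by
  have hc : Continuous fun q : ℝ × EuclideanSpace ℝ (Fin n) => scaling y L q.1 q.2 := by
    unfold scaling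
    fun_prop
  have := (isCompact_closedBall (0 : EuclideanSpace ℝ (Fin n)) R).eventually_forall_of_forall_eventually
    (x₀ := (0 : ℝ)) (P := fun ε z => scaling y L ε z ∈ U) fun z _ => by
      refine hc.continuousAt.eventually_mem ?_
      simpa [scaling] using hU
  exact this.filter_mono nhdsWithin_le_nhds

-- The normalised density equals `1` at the centre, so it tends to `1` pointwise and is below `2` on
-- the ball for small `ε`; dominated convergence applies.
omit [MeasurableSpace M] [BorelSpace M] in
theorem tendsto_integral_scaledDensity_mul (g : Metric n M) {x : M}
    (hy : y ∈ (chartAt (EuclideanSpace ℝ (Fin n)) x).target)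
    (hL : ∀ a b, chartMetric g x y (L a) (L b) = inner ℝ a b)
    {Φ : EuclideanSpace ℝ (Fin n) → ℝ} (hΦ : Continuous Φ) {R : ℝ}
    (hΦR : Function.support Φ ⊆ Metric.closedBall 0 R) :
    Tendsto (fun ε => ∫ z, scaledDensity g x y L ε z * Φ z) (𝓝[>] 0) (𝓝 (∫ z, Φ z)) := by
  set dL := |(L : EuclideanSpace ℝ (Fin n) →L[ℝ] EuclideanSpace ℝ (Fin n)).det|
  have htgt := (chartAt (EuclideanSpace ℝ (Fin n)) x).open_target.mem_nhds hy
  have h1 : dL * chartDensity g x y = 1 := abs_det_mul_chartDensity g hL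
  have hc : ContinuousAt (fun z => dL * chartDensity g x z) y :=
    continuousAt_const.mul ((continuousOn_chartDensity g x).continuousAt htgt)
  have hU : {z | dL * chartDensity g x z < 2} ∈ 𝓝 y :=
    hc.eventually_lt continuousAt_const (by rw [h1]; norm_num)
  have hΦi : Integrable Φ := hΦ.integrable_of_hasCompactSupport
    (HasCompactSupport.of_support_subset_isCompact (isCompact_closedBall _ _) hΦR)
  refine tendsto_integral_filter_of_dominated_convergence (fun z => 2 * ‖Φ z‖) ?_ ?_
    (hΦi.norm.const_mul 2) (Eventually.of_forall fun z => ?_)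
  · filter_upwards [eventually_scaling_mem (L := L) htgt R] with ε hε
    exact (integrable_scaledDensity_mul g hε hΦ hΦR).aestronglyMeasurable
  · filter_upwards [eventually_scaling_mem (L := L) hU R] with ε hε
    refine Eventually.of_forall fun z => ?_
    rw [norm_mul, Real.norm_of_nonneg (scaledDensity_nonneg g x z)]
    by_cases hz : z ∈ Metric.closedBall (0 : EuclideanSpace ℝ (Fin n)) R
    · exact mul_le_mul_of_nonneg_right (hε z hz).le (norm_nonneg _)
    · have : Φ z = 0 := by
        by_contra hne
        exact hz (hΦR hne)
      simp [this]
  · have hs : Tendsto (fun ε : ℝ => scaling y L ε z) (𝓝[>] 0) (𝓝 y) := by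
      have : Continuous fun ε : ℝ => scaling y L ε z := by
        unfold scaling
        fun_prop
      have h0 := this.tendsto 0
      simp only [scaling, zero_smul, add_zero] at h0
      exact h0.mono_left nhdsWithin_le_nhds
    have := (hc.tendsto.comp hs).mul_const (Φ z)
    rw [h1, one_mul] at this
    exact this

/-- Concentration at a point turns the Riemannian inequality into the Euclidean one, for test
functions. -/
theorem RiemannianEntropyInequality.entropyBound [T2Space M] [Nonempty M] {g : Metric n M}
    {p A B : ℝ} (hAB : RiemannianEntropyInequality g p A B) (hn : 0 < n) (hp : 0 < p)
    {φ : EuclideanSpace ℝ (Fin n) → ℝ} (hφ : ContDiff ℝ ∞ φ) (hφs : HasCompactSupport φ)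
    (hm : 0 < ∫ z, |φ z| ^ p) :
    EntropyBound n p (max A 0) volume φ (∫ z, ‖fderiv ℝ φ z‖ ^ p) := by
  obtain ⟨x⟩ := ‹Nonempty M›
  have hn' : (0 : ℝ) < n := by exact_mod_cast hn
  set y := chartAt (EuclideanSpace ℝ (Fin n)) x x
  have hy : y ∈ (chartAt (EuclideanSpace ℝ (Fin n)) x).target := mem_chart_target _ x
  have htgt := (chartAt (EuclideanSpace ℝ (Fin n)) x).open_target.mem_nhds hy
  obtain ⟨L, hL⟩ := exists_normalising_equiv g hy
  obtain ⟨R, hR⟩ := hφs.isCompact.isBounded.subset_closedBall (0 : EuclideanSpace ℝ (Fin n))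
  have hφp : Continuous fun z => |φ z| ^ p := hφ.continuous.abs.rpow_const fun _ => Or.inr hp.le
  have hφe : Continuous (entDensity p φ) := (continuous_entDensity_real hp).comp hφ.continuous
  have hφg : Continuous fun z => ‖fderiv ℝ φ z‖ ^ p :=
    (hφ.continuous_fderiv (by simp)).norm.rpow_const fun _ => Or.inr hp.le
  have sp : Function.support (fun z => |φ z| ^ p) ⊆ Metric.closedBall 0 R := fun z hz => by
    refine hR (subset_tsupport φ fun h0 => ?_)
    simp [h0, hp.ne'] at hz
  have se : Function.support (entDensity p φ) ⊆ Metric.closedBall 0 R := fun z hz => by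
    refine hR (subset_tsupport φ fun h0 => ?_)
    simp [entDensity, h0, hp.ne'] at hz
  have sg : Function.support (fun z => ‖fderiv ℝ φ z‖ ^ p) ⊆ Metric.closedBall 0 R := fun z hz => by
    refine hR (support_fderiv_subset ℝ fun h0 => ?_)
    simp [h0, hp.ne'] at hz
  have tm := tendsto_integral_scaledDensity_mul g hy hL hφp sp
  have te := tendsto_integral_scaledDensity_mul g hy hL hφe se
  have tg := tendsto_integral_scaledDensity_mul g hy hL hφg sg
  have tε : Tendsto (fun ε : ℝ => ε ^ p) (𝓝[>] 0) (𝓝 0) := by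
    have := (Real.continuousAt_rpow_const 0 p (Or.inr hp.le)).tendsto
    rw [Real.zero_rpow hp.ne'] at this
    exact this.mono_left nhdsWithin_le_nhds
  refine ⟨hφe.integrable_of_hasCompactSupport
    (HasCompactSupport.of_support_subset_isCompact (isCompact_closedBall _ _) se), ?_⟩
  set m := ∫ z, |φ z| ^ p
  set Γ := ∫ z, ‖fderiv ℝ φ z‖ ^ p
  -- The limits are taken in order: `ε → 0` at fixed `l`, since the admissible `ε` depend on `l`,
  -- and only then `l → 1`.
  have key : ∀ l : ℝ, 1 < l → Real.exp (p / n * ((∫ z, entDensity p φ z) / m - Real.log m)) ≤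
      max A 0 * (l ^ p * Γ / m) := by
    intro l hl
    have hlim : Tendsto (fun ε => max A 0 * (l ^ p *
        (∫ z, scaledDensity g x y L ε z * ‖fderiv ℝ φ z‖ ^ p) /
        ∫ z, scaledDensity g x y L ε z * |φ z| ^ p) + max B 0 * ε ^ p) (𝓝[>] 0)
        (𝓝 (max A 0 * (l ^ p * Γ / m))) := by
      simpa using (((tg.const_mul (l ^ p)).div tm hm.ne').const_mul (max A 0)).add
        (tε.const_mul (max B 0))
    refine le_of_tendsto_of_tendsto ((((te.div tm hm.ne').sub (tm.log hm.ne')).const_mul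
      (p / n)).rexp) hlim ?_
    filter_upwards [eventually_scaling_mem (L := L) htgt R, eventually_scaling_mem (L := L)
      (eventually_norm_sq_le_chartMetric g hy hL hl) R, tm.eventually (lt_mem_nhds hm),
      self_mem_nhdsWithin] with ε h1 h2 h3 h4
    exact hAB.transplant hn' hp h4 (by linarith) h1 h2 hφ hR h3
  have hl : Tendsto (fun l : ℝ => max A 0 * (l ^ p * Γ / m)) (𝓝[>] 1)
      (𝓝 (max A 0 * Γ / m)) := by
    have h1 := (Real.continuousAt_rpow_const 1 p (Or.inr hp.le)).tendsto
    rw [Real.one_rpow] at h1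
    have h2 := (((h1.mul_const Γ).div_const m).const_mul (max A 0)).mono_left
      (nhdsWithin_le_nhds (s := Ioi 1))
    rwa [one_mul, ← mul_div_assoc] at h2
  refine ge_of_tendsto hl ?_
  filter_upwards [self_mem_nhdsWithin] with l h
  exact key l h

theorem RiemannianEntropyInequality.euclidean [T2Space M] [Nonempty M] {g : Metric n M}
    {p A B : ℝ} (hAB : RiemannianEntropyInequality g p A B) (hn : 0 < n) (hp : 1 ≤ p) :
    EuclideanEntropyInequality n p A := by
  have hp0 : 0 < p := by linarith
  set f : ContDiffBump (0 : EuclideanSpace ℝ (Fin n)) := ⟨1, 2, one_pos, one_lt_two⟩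
  have hf : 0 < ∫ z, |f z| ^ p := by
    have hc : Continuous fun z => |f z| ^ p := f.continuous.abs.rpow_const fun _ => Or.inr hp0.le
    refine hc.integral_pos_of_hasCompactSupport_nonneg_nonzero (x := 0)
      (f.hasCompactSupport.comp_left (g := fun t : ℝ => |t| ^ p) (by simp [hp0.ne']))
      (fun z => by positivity) ?_
    rw [f.one_of_mem_closedBall (Metric.mem_closedBall_self f.rIn_pos.le)]
    simp
  have hbd := (hAB.entropyBound hn hp0 f.contDiff f.hasCompactSupport hf).bound
  -- With `A ≤ 0` the bound for a single bump would put an exponential below `0`. Positivity removes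
  -- the `max`.
  have hA : 0 < A := by
    by_contra hA
    rw [max_eq_right (not_lt.1 hA), zero_mul, zero_div] at hbd
    exact absurd hbd (not_le.2 (Real.exp_pos _))
  refine EuclideanEntropyInequality.of_test hn hp hA.le fun φ hφ hφs hφ0 => ?_
  simpa only [max_eq_left hA.le] using hAB.entropyBound hn hp0 hφ hφs hφ0

end Limit

end EntropyConst

end

theorem proposition2p2 {n : ℕ} (hn : 2 ≤ n) {p : ℝ} (hp1 : 1 < p) (hpn : p < n)
    {M : Type*} [TopologicalSpace M] [T2Space M] [CompactSpace M] [Nonempty M]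
    [ChartedSpace (EuclideanSpace ℝ (Fin n)) M] [IsManifold (𝓡 n) ∞ M]
    [MeasurableSpace M] [BorelSpace M]
    (g : EntropyConst.Metric n M) :
    EntropyConst.euclideanBestConst n p ≤ EntropyConst.riemannianBestConst g p := by
  -- Each `A` admissible on `M` competes in the Euclidean infimum.
  refine le_iInf₂ fun A hA => ?_
  obtain ⟨B, hB⟩ := hA
  exact iInf₂_le A (hB.euclidean (by omega) hp1.le)
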